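/- Let $\mathbb{K}\in\{\mathbb{R},\mathbb{C}\}$, $\mathbb{N}=\{1,2,\dots\}$, $\log=\log_2$, $a_+=\max(a,0)$ and $1/\infty=0$. For $N\in\mathbb{N}$ and $1\le p\le\infty$ let $L_p^N$ be the space of functions $f:\{1,\dots,N\}\to\mathbb{K}$ with the norm $\|f\|_{L_p^N}=\big(\frac1N\sum_{i=1}^N|f(i)|^p\big)^{1/p}$ if $p<\infty$ and $\|f\|_{L_\infty^N}=\max_i|f(i)|$. For $N_1,N_2\in\mathbb{N}$ let $L_p^{N_1}(L_u^{N_2})$ be the space of $f:\{1,\dots,N_1\}\times\{1,\dots,N_2\}\to\mathbb{K}$ with the norm $\big\|\big(\|f(i,\cdot)\|_{L_u^{N_2}}\big)_{i=1}^{N_1}\big\|_{L_p^{N_1}}$. Fix $1\le p,q,u,v\le\infty$. The problem is to approximate the identity embedding $J:L_p^{N_1}(L_u^{N_2})\to G:=L_q^{N_1}(L_v^{N_2})$, $Jf=f$, on the unit ball $F$ of $L_p^{N_1}(L_u^{N_2})$ from function values $f(i,j)$. A deterministic algorithm $A$ consists of arbitrary maps $L_{k+1}:\mathbb{K}^k\to\{1,\dots,N_1\}\times\{1,\dots,N_2\}$,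 $\tau_k:\mathbb{K}^k\to\{0,1\}$ and $\varphi_k:\mathbb{K}^k\to G$ for $k=0,1,2,\dots$ (constants for $k=0$). At input $f$ it observes successively $y_{k+1}=f(L_{k+1}(y_1,\dots,y_k))$; its cardinality $\mathrm{card}(A,f)$ is the least $k\ge0$ with $\tau_k(y_1,\dots,y_k)=1$ ($\infty$ if there is none), and its output $A(f)$ is $\varphi_k(y_1,\dots,y_k)$ if $\mathrm{card}(A,f)=k<\infty$, and $\varphi_0$ if $\mathrm{card}(A,f)=\infty$. It is non-adaptive if all $L_k$ and all $\tau_k$ are constant. A randomized algorithm is a family $(A_\omega)_{\omega\in\Omega}$ of deterministic algorithms over a probability space $(\Omega,\Sigma,\mathbb{P})$ such that, for every $f\in F$, both $\omega\mapsto\mathrm{card}(A_\omega,f)$ and $\omega\mapsto A_\omega(f)\in G$ are measurable; it is non-adaptive if every $A_\omega$ is. Define $$e_n^{\rm ran}=\inf_{(A_\omega)}\ \sup_{f\in F}\ \mathbb{E}\,\|f-A_\omega(f)\|_{L_q^{N_1}(L_v^{N_2})},$$ where the infimum is over all randomized algorithms with $\mathbb{E}\,\mathrm{card}(A_\omega,f)\le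 n$ for all $f\in F$, and define $e_n^{\rm ran-non}$ in the same way with the infimum over the non-adaptive ones only. **Theorem.** Let $1\le p,q,u,v\le\infty$. There are constants $0<c_0<1$ and $c_1,\dots,c_6>0$ such that for all $n,N_1,N_2\in\mathbb{N}$ with $n<c_0N_1N_2$ the following hold. - If $p\ge q$ or $u\le v$, then $$c_1N_1^{(1/p-1/q)_+}N_2^{(1/u-1/v)_+}\le e_n^{\rm ran}\le e_n^{\rm ran-non}\le c_2N_1^{(1/p-1/q)_+}N_2^{(1/u-1/v)_+}.$$ - If $p<q$ and $u>v$, then $$c_3N_1^{1/p-1/q}\Big(\Big\lceil\frac n{N_1}\Big\rceil^{1/u-1/v}+\Big\lceil\frac n{N_2}\Big\rceil^{1/q-1/p}\Big)\le e_n^{\rm ran}\le c_4N_1^{1/p-1/q}\Big(\Big\lceil\frac n{N_1\log(N_1+N_2)}\Big\rceil^{1/u-1/v}+\Big\lceil\frac n{N_2\log(N_1+N_2)}\Big\rceil^{1/q-1/p}\Big)$$ and $$c_5N_1^{1/p-1/q}\le e_n^{\rm ran-non}\le c_6N_1^{1/p-1/q}.$$ -/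

import Mathlib

open scoped ENNReal

universe w

namespace IBC

/-- A numerical problem: `F` is the set of inputs, `G` the target space, whose norm is `gnorm`,
`S` the solution operator and `info` the set of information functionals, with values in `K`. -/
structure NumericalProblem (F G K : Type*) where
  S : F → G
  gnorm : G → ℝ
  info : Set (F → K)

/-- A deterministic (adaptive) algorithm. After `i` values have been observed, `L i` selects the
next (the `(i+1)`-st) information functional, `τ i` says whether to stop, and `φ i` is the output
if the algorithm stops. The maps are arbitrary; for `i = 0` they are constants, since
`Fin 0 → K` has exactly one element. -/
structure DetAlgorithm {F G K : Type*} (P : NumericalProblem F G K) where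
  L : (i : ℕ) → (Fin i → K) → P.info
  τ : (i : ℕ) → (Fin i → K) → Bool
  φ : (i : ℕ) → (Fin i → K) → G

namespace DetAlgorithm

variable {F G K : Type*} {P : NumericalProblem F G K}

/-- The vector of the first `i` values observed at input `f` (ignoring the stopping rule). -/
def values (A : DetAlgorithm P) (f : F) : (i : ℕ) → Fin i → K
  | 0 => Fin.elim0
  | i + 1 => Fin.snoc (α := fun _ => K) (A.values f i) ((A.L i (A.values f i)).1 f)

/-- The cardinality at input `f`: the first `n` at which the algorithm stops, `⊤` if it never
does. -/
noncomputable def card (A : DetAlgorithm P) (f : F) : ℕ∞ :=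
  ⨅ (n : ℕ) (_ : A.τ n (A.values f n) = true), (n : ℕ∞)

/-- The output at input `f`. If the cardinality is `⊤` then `toNat` is `0`, so that the output is
`φ 0`. -/
noncomputable def output (A : DetAlgorithm P) (f : F) : G :=
  A.φ (A.card f).toNat (A.values f (A.card f).toNat)

/-- Non-adaptive: neither the functionals nor the stopping rule depend on observed values. -/
def IsNonadaptive (A : DetAlgorithm P) : Prop :=
  ∀ (i : ℕ) (y z : Fin i → K), A.L i y = A.L i z ∧ A.τ i y = A.τ i z

end DetAlgorithm

/-- A randomized algorithm: a family of deterministic algorithms indexed by a probability space. -/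
structure RanAlgorithm {F G K : Type*} (P : NumericalProblem F G K) where
  Ω : Type w
  mΩ : MeasurableSpace Ω
  ℙ : @MeasureTheory.Measure Ω mΩ
  isProb : MeasureTheory.IsProbabilityMeasure ℙ
  alg : Ω → DetAlgorithm P

attribute [instance] RanAlgorithm.mΩ RanAlgorithm.isProb

namespace RanAlgorithm

variable {F G K : Type*} {P : NumericalProblem F G K}

/-- Membership in the class of randomized algorithms of cardinality at most `n`. -/
structure HasCardLE [TopologicalSpace G] [MeasurableSpace G] [BorelSpace G]
    (A : RanAlgorithm.{w} P) (n : ℕ) : Prop where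
  measurable_card : ∀ f, Measurable fun ω => (A.alg ω).card f
  expected_card_le : ∀ f, ∫⁻ ω, ((A.alg ω).card f : ℝ≥0∞) ∂A.ℙ ≤ n
  measurable_output : ∀ f, Measurable fun ω => (A.alg ω).output f
  separable : ∀ f, ∃ T : Set G, TopologicalSpace.IsSeparable T ∧ ∀ᵐ ω ∂A.ℙ, (A.alg ω).output f ∈ T

def IsNonadaptive (A : RanAlgorithm.{w} P) : Prop :=
  ∀ ω, (A.alg ω).IsNonadaptive

/-- The error: the supremum over all inputs of the expected distance to the exact solution. -/
noncomputable def error [Sub G] (A : RanAlgorithm.{w} P) : ℝ≥0∞ :=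
  ⨆ f, ∫⁻ ω, ENNReal.ofReal (P.gnorm (P.S f - (A.alg ω).output f)) ∂A.ℙ

end RanAlgorithm

section MinimalErrors

variable {F G K : Type*} [Sub G] [TopologicalSpace G] [MeasurableSpace G] [BorelSpace G]

/-- The randomized (adaptive) `n`-th minimal error. -/
noncomputable def eRan (P : NumericalProblem F G K) (n : ℕ) : ℝ≥0∞ :=
  ⨅ (A : RanAlgorithm.{w} P) (_ : A.HasCardLE n), A.error

/-- The randomized non-adaptive `n`-th minimal error. -/
noncomputable def eRanNon (P : NumericalProblem F G K) (n : ℕ) : ℝ≥0∞ :=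
  ⨅ (A : RanAlgorithm.{w} P) (_ : A.HasCardLE n) (_ : A.IsNonadaptive), A.error

end MinimalErrors

/-- The norm of `L_p^N`, i.e. of `L_p` of the uniform probability measure on `N` points. -/
noncomputable def lNorm {E : Type*} [Norm E] (p : ℝ≥0∞) {N : ℕ} (f : Fin N → E) : ℝ :=
  if p = ∞ then ⨆ i, ‖f i‖
  else ((1 / (N : ℝ)) * ∑ i, ‖f i‖ ^ p.toReal) ^ (1 / p.toReal)

/-- The norm of `L_p^{N₁}(L_u^{N₂})`. -/
noncomputable def mixedNorm {𝕜 : Type*} [Norm 𝕜] (p u : ℝ≥0∞) {N₁ N₂ : ℕ}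
    (f : Fin N₁ → Fin N₂ → 𝕜) : ℝ :=
  lNorm p fun i => lNorm u (f i)

/-- The unit ball of `L_p^{N₁}(L_u^{N₂})`. -/
def MixedBall (𝕜 : Type*) [Norm 𝕜] (p u : ℝ≥0∞) (N₁ N₂ : ℕ) : Type _ :=
  {f : Fin N₁ → Fin N₂ → 𝕜 // mixedNorm p u f ≤ 1}

/-- Approximation of the embedding `J : L_p^{N₁}(L_u^{N₂}) → L_q^{N₁}(L_v^{N₂})`, `J f = f`, on the
unit ball, with function values `f(i,j)` as information. The target is the finite-dimensional space
of `N₁ × N₂` matrices, whose Borel sets are those of the product topology. -/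
noncomputable def approxProblem (𝕜 : Type*) [Norm 𝕜] (p u q v : ℝ≥0∞) (N₁ N₂ : ℕ) :
    NumericalProblem (MixedBall 𝕜 p u N₁ N₂) (Fin N₁ → Fin N₂ → 𝕜) 𝕜 where
  S := fun f => f.1
  gnorm := mixedNorm q v
  info := Set.range fun (ij : Fin N₁ × Fin N₂) (f : MixedBall 𝕜 p u N₁ N₂) => f.1 ij.1 ij.2

end IBC

/-! Write P, V for the real exponents of p and v, and α = 1/p - 1/q, δ = 1/v - 1/u.

Lower bounds are average-case. Inputs are built from independent blocks b: a block takes the value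
`0`, `M` or `-M` on one of |D| disjoint sets `S b d`. A run on the input whose block b is zero
cannot depend on d. If it does not touch `S b d`, both signs in that place yield the same output, so
one of the two errors is at least `M` on average there. Touching all places costs |D| evaluations
per block. The resulting inequality (`sum_error_spikes`) is linear in the number of evaluations, so
it integrates over the random parameter and needs only the expected cardinality
(`le_error_of_forall_le_mean`). Three supports give the adaptive bounds: random signs on m full
rows, one spike per row, and a random residue class modulo k in a random row. For p < q and v < u
the first and third, with m and k of order ⌈6n/N₂⌉ and ⌈6n/N₁⌉, give the two summands. A
non-adaptive method cannot concentrate on a hidden row filled with random signs, hence N₁^α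
(`le_eRanNon_of_row`).

All upper bounds except the adaptive one for p < q, v < u come from the zero algorithm and the norm
of the embedding. In that case a two-stage method works. It samples R groups of k columns, the same
ones in every row, and then reads completely the rows whose empirical V-th moment exceeds θ in every
group. By Markov's inequality a row g is detected with probability at most (‖g‖_v^V/θ)^R, and R ≥
P/V makes the expected number of detected rows at most N₁/θ^(P/V). A missed row of large v-norm is
handled by a truncated Chernoff bound: its missing probability times ‖g‖_v^P is at most a constant
times (k^(-δ)‖g‖_u)^P, which sums over the rows. A row of small norm contributes little by
interpolation between p and ∞ (`lNorm_small_le`).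

Because missed rows are controlled in p-mean and not by a union bound over all rows, no logarithm
appears: `exists_eRan_le` is stronger than the stated upper bound, which follows since log(N₁+N₂) ≥
1. -/

namespace IBC

/-! ### Normalised Lebesgue norms on finite sets -/

section LNorm

variable {E E' : Type*} [SeminormedAddCommGroup E] [SeminormedAddCommGroup E'] {N : ℕ}
  {p q : ℝ≥0∞}

lemma one_le_toReal (hp : 1 ≤ p) (hpt : p ≠ ∞) : 1 ≤ p.toReal := by
  simpa using (ENNReal.toReal_le_toReal (by simp) hpt).2 hp

lemma toReal_inv_anti (hp : 1 ≤ p) (hpq : p ≤ q) : (q⁻¹).toReal ≤ (p⁻¹).toReal :=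
  ENNReal.toReal_mono (ENNReal.inv_ne_top.2 (zero_lt_one.trans_le hp).ne') (ENNReal.inv_le_inv.2 hpq)

lemma toReal_inv_le_one (hp : 1 ≤ p) : (p⁻¹).toReal ≤ 1 := by
  simpa using toReal_inv_anti le_rfl hp

lemma toReal_inv_strictAnti (hp : 1 ≤ p) (hpq : p < q) : (q⁻¹).toReal < (p⁻¹).toReal :=
  (ENNReal.toReal_lt_toReal (ENNReal.inv_ne_top.2 (zero_lt_one.trans (hp.trans_lt hpq)).ne')
    (ENNReal.inv_ne_top.2 (zero_lt_one.trans_le hp).ne')).2 (ENNReal.inv_lt_inv.2 hpq)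

lemma lNorm_top (f : Fin N → E) : lNorm ∞ f = ⨆ i, ‖f i‖ := by simp [lNorm]

lemma lNorm_of_ne_top (hp : p ≠ ∞) (f : Fin N → E) :
    lNorm p f = ((1 / (N : ℝ)) * ∑ i, ‖f i‖ ^ p.toReal) ^ (1 / p.toReal) := by
  simp [lNorm, hp]

lemma mean_rpow_nonneg (r : ℝ) (f : Fin N → E) : 0 ≤ (1 / (N : ℝ)) * ∑ i, ‖f i‖ ^ r := by
  positivity

lemma lNorm_nonneg (p : ℝ≥0∞) (f : Fin N → E) : 0 ≤ lNorm p f := by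
  by_cases hp : p = ∞
  · subst hp; rw [lNorm_top]; exact Real.iSup_nonneg fun i => norm_nonneg _
  · rw [lNorm_of_ne_top hp]; exact Real.rpow_nonneg (mean_rpow_nonneg _ _) _

lemma lNorm_rpow (hp : 1 ≤ p) (hpt : p ≠ ∞) (f : Fin N → E) :
    lNorm p f ^ p.toReal = (1 / (N : ℝ)) * ∑ i, ‖f i‖ ^ p.toReal := by
  have := one_le_toReal hp hpt
  rw [lNorm_of_ne_top hpt, ← Real.rpow_mul (mean_rpow_nonneg _ _),
    one_div_mul_cancel (by positivity), Real.rpow_one]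

lemma lNorm_le_iff (hp : 1 ≤ p) (hpt : p ≠ ∞) (f : Fin N → E) {c : ℝ} (hc : 0 ≤ c) :
    lNorm p f ≤ c ↔ (1 / (N : ℝ)) * ∑ i, ‖f i‖ ^ p.toReal ≤ c ^ p.toReal := by
  have := one_le_toReal hp hpt
  rw [← lNorm_rpow hp hpt, Real.rpow_le_rpow_iff (lNorm_nonneg _ _) hc (by positivity)]

lemma le_lNorm_iff (hp : 1 ≤ p) (hpt : p ≠ ∞) (f : Fin N → E) {c : ℝ} (hc : 0 ≤ c) :
    c ≤ lNorm p f ↔ c ^ p.toReal ≤ (1 / (N : ℝ)) * ∑ i, ‖f i‖ ^ p.toReal := by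
  have := one_le_toReal hp hpt
  rw [← lNorm_rpow hp hpt, Real.rpow_le_rpow_iff hc (lNorm_nonneg _ _) (by positivity)]

lemma lNorm_top_le (f : Fin N → E) {c : ℝ} (hc : 0 ≤ c) (h : ∀ i, ‖f i‖ ≤ c) : lNorm ∞ f ≤ c := by
  rw [lNorm_top]; exact Real.iSup_le h hc

lemma norm_le_lNorm_top (f : Fin N → E) (i : Fin N) : ‖f i‖ ≤ lNorm ∞ f := by
  rw [lNorm_top]; exact le_ciSup (f := fun i => ‖f i‖) (Set.finite_range _).bddAbove i

lemma lNorm_mono (hp : 1 ≤ p) {f : Fin N → E} {g : Fin N → E'} (h : ∀ i, ‖f i‖ ≤ ‖g i‖) :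
    lNorm p f ≤ lNorm p g := by
  by_cases hpt : p = ∞
  · subst hpt
    exact lNorm_top_le _ (lNorm_nonneg _ _) fun i => (h i).trans (norm_le_lNorm_top g i)
  · rw [lNorm_le_iff hp hpt _ (lNorm_nonneg _ _), lNorm_rpow hp hpt]
    gcongr with i
    exact h i

lemma toReal_inv_mul_toReal (hp : 1 ≤ p) (hpt : p ≠ ∞) : (p⁻¹).toReal * p.toReal = 1 := by
  have := one_le_toReal hp hpt
  rw [ENNReal.toReal_inv, inv_mul_cancel₀ (by positivity)]

lemma lNorm_le_of_support (hp : 1 ≤ p) (f : Fin N → E) (S : Finset (Fin N)) {M : ℝ} (hM : 0 ≤ M)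
    (h : ∀ i ∈ S, ‖f i‖ ≤ M) (h0 : ∀ i ∉ S, ‖f i‖ = 0) :
    lNorm p f ≤ M * ((S.card : ℝ) / N) ^ (p⁻¹).toReal := by
  by_cases hpt : p = ∞
  · subst hpt
    refine lNorm_top_le _ (by positivity) fun i => ?_
    by_cases hi : i ∈ S
    · simpa using h i hi
    · simpa [h0 i hi] using hM
  · have h1 := one_le_toReal hp hpt
    rw [lNorm_le_iff hp hpt _ (by positivity), Real.mul_rpow hM (by positivity),
      ← Real.rpow_mul (by positivity), toReal_inv_mul_toReal hp hpt, Real.rpow_one]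
    have : ∑ i, ‖f i‖ ^ p.toReal ≤ S.card * M ^ p.toReal := by
      rw [← Finset.sum_subset (Finset.subset_univ S) (fun i _ hi => by
        rw [h0 i hi, Real.zero_rpow (by positivity)]), ← nsmul_eq_mul]
      exact Finset.sum_le_card_nsmul _ _ _ fun i hi =>
        Real.rpow_le_rpow (norm_nonneg _) (h i hi) (by positivity)
    calc (1 / (N : ℝ)) * ∑ i, ‖f i‖ ^ p.toReal ≤ (1 / (N : ℝ)) * (S.card * M ^ p.toReal) := by
          gcongr
      _ = _ := by ring

lemma mean_rpow_le {ι : Type*} (S : Finset ι) (g : ι → ℝ) (hg : ∀ i ∈ S, 0 ≤ g i) {r : ℝ}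
    (hr : 1 ≤ r) (hS : S.Nonempty) :
    ((1 / (S.card : ℝ)) * ∑ i ∈ S, g i) ^ r ≤ (1 / (S.card : ℝ)) * ∑ i ∈ S, g i ^ r := by
  have hc : (0 : ℝ) < S.card := by exact_mod_cast hS.card_pos
  have := Real.rpow_arith_mean_le_arith_mean_rpow S (fun _ => 1 / (S.card : ℝ)) g
    (fun i _ => by positivity) (by simp [hc.ne']) hg hr
  simpa only [Finset.mul_sum] using this

/-- Jensen's inequality on `S`, after discarding the points outside `S`. This is sharp for multiples
of the indicator of `S`, and so matches `lNorm_le_of_support`. -/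
lemma mean_le_lNorm (hp : 1 ≤ p) (f : Fin N → E) (S : Finset (Fin N)) (hS : S.Nonempty) :
    ((S.card : ℝ) / N) ^ (p⁻¹).toReal * ((1 / (S.card : ℝ)) * ∑ i ∈ S, ‖f i‖) ≤ lNorm p f := by
  have hc : (0 : ℝ) < S.card := by exact_mod_cast hS.card_pos
  by_cases hpt : p = ∞
  · subst hpt
    have : ∑ i ∈ S, ‖f i‖ ≤ S.card * lNorm ∞ f := by
      rw [← nsmul_eq_mul]
      exact Finset.sum_le_card_nsmul _ _ _ fun i _ => norm_le_lNorm_top f i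
    simp only [ENNReal.inv_top, ENNReal.toReal_zero, Real.rpow_zero, one_mul]
    rw [one_div, inv_mul_le_iff₀ hc]
    exact this
  · have h1 := one_le_toReal hp hpt
    rw [le_lNorm_iff hp hpt _ (by positivity), Real.mul_rpow (by positivity) (by positivity),
      ← Real.rpow_mul (by positivity), toReal_inv_mul_toReal hp hpt, Real.rpow_one]
    calc (S.card : ℝ) / N * ((1 / (S.card : ℝ)) * ∑ i ∈ S, ‖f i‖) ^ p.toReal
        ≤ (S.card : ℝ) / N * ((1 / (S.card : ℝ)) * ∑ i ∈ S, ‖f i‖ ^ p.toReal) := by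
          gcongr
          exact mean_rpow_le S _ (fun _ _ => norm_nonneg _) h1 hS
      _ = (1 / (N : ℝ)) * ∑ i ∈ S, ‖f i‖ ^ p.toReal := by field_simp
      _ ≤ _ := by
          gcongr
          exact Finset.subset_univ S

lemma norm_le_rpow_mul_lNorm (hp : 1 ≤ p) (f : Fin N → E) (i : Fin N) :
    ‖f i‖ ≤ (N : ℝ) ^ (p⁻¹).toReal * lNorm p f := by
  have hN : (0 : ℝ) < N := by exact_mod_cast i.pos
  have := mean_le_lNorm hp f {i} (by simp)
  simp only [Finset.card_singleton, Nat.cast_one, Finset.sum_singleton, div_one, one_mul, one_div,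
    Real.inv_rpow hN.le] at this
  rwa [inv_mul_le_iff₀ (by positivity)] at this

/-- Pointwise `‖f i‖ ^ Q ≤ t ^ (Q - P) * ‖f i‖ ^ P`, with P and Q the real exponents of p and q.
With `t` the trivial bound N^(1/p)‖f‖_p it yields the embedding constant; with a small `t` it
handles the rows of small norm. -/
lemma lNorm_le_interpolate (hp : 1 ≤ p) (hpq : p < q) (f : Fin N → E) {t : ℝ} (ht : 0 ≤ t)
    (h : ∀ i, ‖f i‖ ≤ t) :
    lNorm q f ≤ t ^ (1 - p.toReal * (q⁻¹).toReal) * lNorm p f ^ (p.toReal * (q⁻¹).toReal) := by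
  have hpt : p ≠ ∞ := hpq.ne_top
  have hP := one_le_toReal hp hpt
  by_cases hqt : q = ∞
  · subst hqt
    simpa using lNorm_top_le f ht h
  · have hq : 1 ≤ q := hp.trans hpq.le
    have hQ := one_le_toReal hq hqt
    have hPQ : p.toReal < q.toReal := (ENNReal.toReal_lt_toReal hpt hqt).2 hpq
    have e := toReal_inv_mul_toReal hq hqt
    rw [lNorm_le_iff hq hqt _ (mul_nonneg (by positivity) (Real.rpow_nonneg (lNorm_nonneg _ _) _)),
      Real.mul_rpow (by positivity) (Real.rpow_nonneg (lNorm_nonneg _ _) _), ← Real.rpow_mul ht,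
      ← Real.rpow_mul (lNorm_nonneg _ _), mul_assoc, e, mul_one, lNorm_rpow hp hpt,
      mul_left_comm]
    refine mul_le_mul_of_nonneg_left ?_ (by positivity)
    rw [Finset.mul_sum]
    gcongr with i
    have : (1 - p.toReal * (q⁻¹).toReal) * q.toReal = q.toReal - p.toReal := by
      linear_combination (-p.toReal) * e
    rw [this]
    calc ‖f i‖ ^ q.toReal = ‖f i‖ ^ (q.toReal - p.toReal) * ‖f i‖ ^ p.toReal := by
          rw [← Real.rpow_add_of_nonneg (norm_nonneg _) (by linarith) (by linarith)]; simp
      _ ≤ _ := by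
          gcongr
          exact h i

lemma lNorm_anti (hq : 1 ≤ q) (hqp : q ≤ p) (hN : 1 ≤ N) (f : Fin N → E) :
    lNorm q f ≤ lNorm p f := by
  have hN' : (0 : ℝ) < N := by exact_mod_cast hN
  have : NeZero N := ⟨by omega⟩
  by_cases hqt : q = ∞
  · subst hqt; simp [top_le_iff.1 hqp]
  have hQ := one_le_toReal hq hqt
  by_cases hpt : p = ∞
  · subst hpt
    rw [lNorm_le_iff hq hqt _ (lNorm_nonneg _ _), one_div, inv_mul_le_iff₀ hN']
    calc _ ≤ ∑ i : Fin N, (lNorm ∞ f) ^ q.toReal := by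
            gcongr with i
            exact norm_le_lNorm_top f i
      _ = _ := by simp
  · have hp : 1 ≤ p := hq.trans hqp
    have hP := one_le_toReal hp hpt
    have hPQ : q.toReal ≤ p.toReal := (ENNReal.toReal_le_toReal hqt hpt).2 hqp
    have := mean_rpow_le (Finset.univ : Finset (Fin N)) (fun i => ‖f i‖ ^ q.toReal)
      (fun _ _ => by positivity) (r := p.toReal / q.toReal) ((one_le_div (by positivity)).2 hPQ)
      Finset.univ_nonempty
    simp only [Finset.card_univ, Fintype.card_fin] at this
    rw [le_lNorm_iff hp hpt _ (lNorm_nonneg _ _)]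
    calc lNorm q f ^ p.toReal = (lNorm q f ^ q.toReal) ^ (p.toReal / q.toReal) := by
          rw [← Real.rpow_mul (lNorm_nonneg _ _)]; congr 1; field_simp
      _ ≤ _ := by
          rw [lNorm_rpow hq hqt]
          refine this.trans (le_of_eq ?_)
          congr 1
          refine Finset.sum_congr rfl fun i _ => ?_
          rw [← Real.rpow_mul (norm_nonneg _)]; congr 1; field_simp

lemma lNorm_le_of_lt (hp : 1 ≤ p) (hpq : p < q) (f : Fin N → E) :
    lNorm q f ≤ (N : ℝ) ^ ((p⁻¹).toReal - (q⁻¹).toReal) * lNorm p f := by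
  have h0 := lNorm_nonneg p f
  have h := lNorm_le_interpolate hp hpq f (t := (N : ℝ) ^ (p⁻¹).toReal * lNorm p f) (by positivity)
    (norm_le_rpow_mul_lNorm hp f)
  refine h.trans (le_of_eq ?_)
  have e := toReal_inv_mul_toReal hp hpq.ne_top
  have hs : 0 ≤ 1 - p.toReal * (q⁻¹).toReal := by
    have h1 := toReal_inv_anti hp hpq.le
    have h2 := one_le_toReal hp hpq.ne_top
    nlinarith
  have hr : 0 ≤ p.toReal * (q⁻¹).toReal := by positivity
  rw [Real.mul_rpow (by positivity) h0, ← Real.rpow_mul (by positivity), mul_assoc,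
    ← Real.rpow_add_of_nonneg h0 hs hr, sub_add_cancel, Real.rpow_one]
  congr 2
  linear_combination (-(q⁻¹).toReal) * e

lemma lNorm_embedding (hp : 1 ≤ p) (hq : 1 ≤ q) (hN : 1 ≤ N) (f : Fin N → E) :
    lNorm q f ≤ (N : ℝ) ^ max ((p⁻¹).toReal - (q⁻¹).toReal) 0 * lNorm p f := by
  rcases le_or_gt q p with h | h
  · rw [max_eq_right (sub_nonpos.2 (toReal_inv_anti hq h))]
    simpa using lNorm_anti hq h hN f
  · rw [max_eq_left (sub_nonneg.2 (toReal_inv_anti hp h.le))]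
    exact lNorm_le_of_lt hp h f

lemma lNorm_const_mul (hp : 1 ≤ p) {a : ℝ} (ha : 0 ≤ a) (f : Fin N → ℝ) :
    lNorm p (fun i => a * f i) = a * lNorm p f := by
  by_cases hpt : p = ∞
  · subst hpt
    simp only [lNorm_top, norm_mul, Real.norm_of_nonneg ha]
    exact (Real.mul_iSup_of_nonneg ha _).symm
  · have hP := one_le_toReal hp hpt
    rw [← Real.rpow_left_inj (lNorm_nonneg _ _) (mul_nonneg ha (lNorm_nonneg _ _))
      (show p.toReal ≠ 0 by positivity), Real.mul_rpow ha (lNorm_nonneg _ _), lNorm_rpow hp hpt,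
      lNorm_rpow hp hpt, mul_left_comm]
    congr 1
    rw [Finset.mul_sum]
    refine Finset.sum_congr rfl fun i _ => ?_
    rw [norm_mul, Real.norm_of_nonneg ha, Real.mul_rpow ha (norm_nonneg _)]

lemma lNorm_le_add (hp : 1 ≤ p) {h : Fin N → E} {f g : Fin N → ℝ} (hh : ∀ i, ‖h i‖ ≤ f i + g i) :
    lNorm p h ≤ lNorm p f + lNorm p g := by
  by_cases hpt : p = ∞
  · subst hpt
    refine lNorm_top_le _ (add_nonneg (lNorm_nonneg _ _) (lNorm_nonneg _ _)) fun i =>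
      (hh i).trans (add_le_add ?_ ?_)
    · exact (Real.le_norm_self _).trans (norm_le_lNorm_top f i)
    · exact (Real.le_norm_self _).trans (norm_le_lNorm_top g i)
  · have hP := one_le_toReal hp hpt
    have h1 : lNorm p h ≤ lNorm p (fun i => f i + g i) :=
      lNorm_mono hp fun i => (hh i).trans (Real.le_norm_self _)
    refine h1.trans ?_
    simp only [lNorm_of_ne_top hpt]
    rw [Real.mul_rpow (by positivity) (by positivity), Real.mul_rpow (by positivity) (by positivity),
      Real.mul_rpow (by positivity) (by positivity), ← mul_add]
    gcongr
    exact Real.Lp_add_le _ _ _ hP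

end LNorm

/-! ### Mixed norms: embedding, supports, measurability -/

section MixedNorm

variable {𝕜 : Type*} [RCLike 𝕜] {p q u v : ℝ≥0∞} {N₁ N₂ : ℕ}

lemma mixedNorm_nonneg (p u : ℝ≥0∞) (f : Fin N₁ → Fin N₂ → 𝕜) : 0 ≤ mixedNorm p u f :=
  lNorm_nonneg _ _

lemma mixedNorm_embedding (hp : 1 ≤ p) (hq : 1 ≤ q) (hu : 1 ≤ u) (hv : 1 ≤ v) (hN₁ : 1 ≤ N₁)
    (hN₂ : 1 ≤ N₂) (f : Fin N₁ → Fin N₂ → 𝕜) :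
    mixedNorm q v f ≤ ((N₁ : ℝ) ^ max ((p⁻¹).toReal - (q⁻¹).toReal) 0 *
      (N₂ : ℝ) ^ max ((u⁻¹).toReal - (v⁻¹).toReal) 0) * mixedNorm p u f := by
  unfold mixedNorm
  refine (lNorm_embedding hp hq hN₁ _).trans ?_
  rw [mul_assoc]
  gcongr
  rw [← lNorm_const_mul hp (by positivity)]
  refine lNorm_mono hp fun i => ?_
  have := lNorm_nonneg u (f i)
  rw [Real.norm_of_nonneg (lNorm_nonneg _ _), Real.norm_of_nonneg (by positivity)]
  exact lNorm_embedding hu hv hN₂ _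

/-- The norm of a function supported on `s` points in each of the rows in `I`. -/
lemma mixedNorm_le_of_support (hp : 1 ≤ p) (hu : 1 ≤ u) (f : Fin N₁ → Fin N₂ → 𝕜)
    (I : Finset (Fin N₁)) (S : Fin N₁ → Finset (Fin N₂)) {s : ℕ} (hS : ∀ i ∈ I, (S i).card = s)
    {M : ℝ} (hM : 0 ≤ M) (h : ∀ i ∈ I, ∀ j ∈ S i, ‖f i j‖ ≤ M)
    (h0 : ∀ i j, ¬ (i ∈ I ∧ j ∈ S i) → f i j = 0) :
    mixedNorm p u f ≤
      M * ((s : ℝ) / N₂) ^ (u⁻¹).toReal * ((I.card : ℝ) / N₁) ^ (p⁻¹).toReal := by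
  refine lNorm_le_of_support hp _ I (by positivity) (fun i hi => ?_) fun i hi => ?_
  · rw [Real.norm_of_nonneg (lNorm_nonneg _ _), ← hS i hi]
    exact lNorm_le_of_support hu _ (S i) hM (h i hi) fun j hj => by simp [h0 i j (by tauto)]
  · rw [Real.norm_of_nonneg (lNorm_nonneg _ _)]
    refine le_antisymm ?_ (lNorm_nonneg _ _)
    have := lNorm_le_of_support hu (f i) ∅ le_rfl (by simp)
      fun j _ => by simp [h0 i j (by tauto)]
    simpa using this

/-- `mean_le_lNorm` in both variables; every chosen row carries the same number `s` of points, so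
the mean of the row means is the mean over all chosen points. -/
lemma mean_le_mixedNorm (hq : 1 ≤ q) (hv : 1 ≤ v) (g : Fin N₁ → Fin N₂ → 𝕜)
    (I : Finset (Fin N₁)) (hI : I.Nonempty) (S : Fin N₁ → Finset (Fin N₂)) {s : ℕ} (hs : 1 ≤ s)
    (hS : ∀ i ∈ I, (S i).card = s) :
    ((I.card : ℝ) / N₁) ^ (q⁻¹).toReal * ((s : ℝ) / N₂) ^ (v⁻¹).toReal *
      ((1 / ((I.card : ℝ) * s)) * ∑ i ∈ I, ∑ j ∈ S i, ‖g i j‖) ≤ mixedNorm q v g := by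
  refine le_trans ?_ (mean_le_lNorm hq _ I hI)
  rw [mul_assoc]
  refine mul_le_mul_of_nonneg_left ?_ (by positivity)
  calc _ = (1 / (I.card : ℝ)) *
        ∑ i ∈ I, ((s : ℝ) / N₂) ^ (v⁻¹).toReal * ((1 / (s : ℝ)) * ∑ j ∈ S i, ‖g i j‖) := by
        rw [← Finset.mul_sum, ← Finset.mul_sum]
        field_simp
    _ ≤ _ := by
        gcongr with i hi
        rw [Real.norm_of_nonneg (lNorm_nonneg _ _), ← hS i hi]
        exact mean_le_lNorm hv (g i) (S i) (Finset.card_pos.1 (by rw [hS i hi]; omega))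

lemma measurable_lNorm (p : ℝ≥0∞) (N : ℕ) : Measurable (lNorm (E := ℝ) p (N := N)) := by
  by_cases hp : p = ∞
  · subst hp
    simp only [funext fun f : Fin N → ℝ => lNorm_top f]
    exact Measurable.iSup fun i => (measurable_pi_apply i).norm
  · simp only [funext fun f : Fin N → ℝ => lNorm_of_ne_top hp f]
    fun_prop

lemma measurable_mixedNorm [MeasurableSpace 𝕜] [BorelSpace 𝕜] (p u : ℝ≥0∞) (N₁ N₂ : ℕ) :
    Measurable (mixedNorm (𝕜 := 𝕜) p u (N₁ := N₁) (N₂ := N₂)) := by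
  refine (measurable_lNorm p N₁).comp (measurable_pi_lambda _ fun i => ?_)
  have : (fun f : Fin N₁ → Fin N₂ → 𝕜 => lNorm u (f i)) =
      fun f => lNorm u (fun j => ‖f i j‖) := by
    funext f; simp [lNorm]
  rw [this]
  exact (measurable_lNorm u N₂).comp (by fun_prop)

end MixedNorm

/-! ### Runs of a deterministic algorithm -/

namespace DetAlgorithm

variable {F G K : Type*} {P : NumericalProblem F G K} (A : DetAlgorithm P)

lemma values_succ (f : F) (i : ℕ) :
    A.values f (i + 1) =
      Fin.snoc (α := fun _ => K) (A.values f i) ((A.L i (A.values f i)).1 f) := rfl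

lemma values_eq_of_agree {f g : F} {n : ℕ}
    (h : ∀ i < n, (A.L i (A.values f i)).1 f = (A.L i (A.values f i)).1 g) :
    ∀ i ≤ n, A.values g i = A.values f i
  | 0, _ => funext fun x => x.elim0
  | i + 1, hi => by
    have ih := values_eq_of_agree h i (by omega)
    rw [values_succ, values_succ, ih, h i (by omega)]

lemma card_le {f : F} {n : ℕ} (h : A.τ n (A.values f n) = true) : A.card f ≤ n :=
  iInf₂_le (f := fun (n : ℕ) (_ : A.τ n (A.values f n) = true) => (n : ℕ∞)) n h

lemma card_eq_coe_iff (f : F) (n : ℕ) :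
    A.card f = n ↔ A.τ n (A.values f n) = true ∧ ∀ m < n, A.τ m (A.values f m) ≠ true := by
  constructor
  · intro h
    have hmem : ∃ m, A.τ m (A.values f m) = true := by
      by_contra! hc
      have : A.card f = ⊤ := by simp [card, hc]
      rw [this] at h
      exact ENat.top_ne_natCast n h
    classical
    have hfind : A.card f = Nat.find hmem := by
      refine le_antisymm (A.card_le (Nat.find_spec hmem)) (le_iInf₂ fun m hm => ?_)
      exact_mod_cast Nat.find_min' hmem hm
    rw [hfind] at h
    have h' : Nat.find hmem = n := by exact_mod_cast h
    exact (Nat.find_eq_iff hmem).1 h'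
  · rintro ⟨h1, h2⟩
    refine le_antisymm (A.card_le h1) (le_iInf₂ fun m hm => ?_)
    by_contra! hc
    exact h2 m (by exact_mod_cast hc) hm

lemma card_eq_of_agree {f g : F} {n : ℕ} (hn : A.card f = n)
    (h : ∀ i < n, (A.L i (A.values f i)).1 f = (A.L i (A.values f i)).1 g) :
    A.card g = n := by
  rw [card_eq_coe_iff] at hn ⊢
  have hv := A.values_eq_of_agree h
  refine ⟨by rw [hv n le_rfl]; exact hn.1, fun m hm => by rw [hv m hm.le]; exact hn.2 m hm⟩

lemma output_of_card_eq {f : F} {n : ℕ} (hn : A.card f = n) :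
    A.output f = A.φ n (A.values f n) := by
  unfold output
  rw [hn]; rfl

lemma output_eq_of_agree {f g : F} {n : ℕ} (hn : A.card f = n)
    (h : ∀ i < n, (A.L i (A.values f i)).1 f = (A.L i (A.values f i)).1 g) :
    A.output g = A.output f := by
  rw [A.output_of_card_eq hn, A.output_of_card_eq (A.card_eq_of_agree hn h),
    A.values_eq_of_agree h n le_rfl]

lemma card_eq_of_isNonadaptive (hA : A.IsNonadaptive) (f g : F) : A.card f = A.card g := by
  unfold card
  congr 1
  funext n
  rw [(hA n (A.values f n) (A.values g n)).2]

end DetAlgorithm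

/-! ### The points evaluated by a run -/

section Seen

variable {𝕜 : Type*} [RCLike 𝕜] {p q u v : ℝ≥0∞} {N₁ N₂ : ℕ}

/-- The point at which the algorithm evaluates the input after having observed `y`. -/
noncomputable def DetAlgorithm.point (A : DetAlgorithm (approxProblem 𝕜 p u q v N₁ N₂)) (i : ℕ)
    (y : Fin i → 𝕜) : Fin N₁ × Fin N₂ :=
  (A.L i y).2.choose

lemma DetAlgorithm.L_apply (A : DetAlgorithm (approxProblem 𝕜 p u q v N₁ N₂)) (i : ℕ)
    (y : Fin i → 𝕜) (f : MixedBall 𝕜 p u N₁ N₂) :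
    (A.L i y).1 f = f.1 (A.point i y).1 (A.point i y).2 :=
  (congrFun (A.L i y).2.choose_spec f).symm

/-- The set of points at which the algorithm evaluates `f`. -/
noncomputable def DetAlgorithm.seen (A : DetAlgorithm (approxProblem 𝕜 p u q v N₁ N₂))
    (f : MixedBall 𝕜 p u N₁ N₂) : Finset (Fin N₁ × Fin N₂) :=
  (Finset.range (A.card f).toNat).image fun i => A.point i (A.values f i)

lemma DetAlgorithm.card_seen_le (A : DetAlgorithm (approxProblem 𝕜 p u q v N₁ N₂))
    (f : MixedBall 𝕜 p u N₁ N₂) : (A.seen f).card ≤ (A.card f).toNat :=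
  Finset.card_image_le.trans (by simp)

lemma DetAlgorithm.seen_eq_of_isNonadaptive
    (A : DetAlgorithm (approxProblem 𝕜 p u q v N₁ N₂)) (hA : A.IsNonadaptive)
    (f g : MixedBall 𝕜 p u N₁ N₂) : A.seen f = A.seen g := by
  unfold seen
  rw [A.card_eq_of_isNonadaptive hA f g]
  congr 1
  funext i
  exact congrArg (fun z : (approxProblem 𝕜 p u q v N₁ N₂).info => z.2.choose)
    (hA i (A.values f i) (A.values g i)).1

/-- Finiteness of the cardinality matters: for a run that never stops, `toNat` is 0 and `seen` is
empty, although the run did query points. -/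
lemma DetAlgorithm.output_eq_of_eq_on_seen
    (A : DetAlgorithm (approxProblem 𝕜 p u q v N₁ N₂)) {f g : MixedBall 𝕜 p u N₁ N₂}
    (hf : A.card f ≠ ⊤) (h : ∀ x ∈ A.seen f, f.1 x.1 x.2 = g.1 x.1 x.2) :
    A.output g = A.output f := by
  have hn : A.card f = ((A.card f).toNat : ℕ∞) := (ENat.natCast_toNat hf).symm
  refine A.output_eq_of_agree hn fun i hi => ?_
  rw [A.L_apply, A.L_apply]
  exact h _ (Finset.mem_image_of_mem _ (Finset.mem_range.2 hi))

end Seen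

/-! ### Resampling one coordinate -/

section Swap

variable {B C : Type*} [DecidableEq B]

/-- Exchanging the value of a function at `b` with a separate value. -/
def swapAt (b : B) : (B → C) × C ≃ (B → C) × C :=
  Function.Involutive.toPerm (fun z => (Function.update z.1 b z.2, z.1 b)) fun z => by simp

/-- Replacing one coordinate of a uniform vector by an independent uniform value leaves the joint
distribution of the vector and the spare value invariant. -/
lemma sum_swapAt [Fintype B] [Fintype C] (b : B) (H : (B → C) → C → ℝ) :
    ∑ c, ∑ x, H (Function.update c b x) (c b) = ∑ c, ∑ x, H c x := by
  rw [← Fintype.sum_prod_type', ← Fintype.sum_prod_type']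
  exact Equiv.sum_comp (swapAt b) fun z : (B → C) × C => H z.1 z.2

lemma sum_sum_update [Fintype B] [Fintype C] (b : B) (H : (B → C) → ℝ) :
    ∑ c, ∑ x, H (Function.update c b x) = Fintype.card C * ∑ c, H c := by
  rw [sum_swapAt b fun c _ => H c, Finset.mul_sum]
  simp

lemma sum_apply_eq [Fintype B] [Fintype C] (b : B) (g : C → ℝ) :
    Fintype.card C * ∑ c : B → C, g (c b) = Fintype.card (B → C) * ∑ x, g x := by
  have := sum_swapAt (B := B) (C := C) b fun _ x => g x
  simpa [Finset.mul_sum] using this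

end Swap

/-! ### Average error over random spikes -/

section Spikes

variable {𝕜 : Type*} [RCLike 𝕜] {p q u v : ℝ≥0∞} {N₁ N₂ : ℕ}
  {B D : Type*} [Fintype B]

/-- The signs `0`, `1`, `-1`. -/
def trit (𝕜 : Type*) [RCLike 𝕜] : Fin 3 → 𝕜 := ![0, 1, -1]

/-- For each `b`, the value is `0` or `± M`, the sign being `(c b).1`, on the set
`S b (c b).2`. -/
noncomputable def spikes (𝕜 : Type*) [RCLike 𝕜] (M : ℝ) (S : B → D → Finset (Fin N₁ × Fin N₂))
    (c : B → Fin 3 × D) : Fin N₁ → Fin N₂ → 𝕜 :=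
  fun i j => ∑ b, if (i, j) ∈ S b (c b).2 then (M : 𝕜) * trit 𝕜 (c b).1 else 0

/-- The mean of `‖g‖` over `T`. -/
noncomputable def meanOn (T : Finset (Fin N₁ × Fin N₂)) (g : Fin N₁ → Fin N₂ → 𝕜) : ℝ :=
  (1 / (T.card : ℝ)) * ∑ x ∈ T, ‖g x.1 x.2‖

lemma meanOn_nonneg (T : Finset (Fin N₁ × Fin N₂)) (g : Fin N₁ → Fin N₂ → 𝕜) :
    0 ≤ meanOn T g := by
  unfold meanOn; positivity

lemma norm_trit_le (s : Fin 3) : ‖trit 𝕜 s‖ ≤ 1 := by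
  fin_cases s <;> simp [trit]

variable {M : ℝ} {S : B → D → Finset (Fin N₁ × Fin N₂)}

variable (hdisj : ∀ b d b' d' x, x ∈ S b d → x ∈ S b' d' → b = b' ∧ d = d')

section
include hdisj

lemma spikes_of_mem (c : B → Fin 3 × D) (b : B) (i : Fin N₁) (j : Fin N₂)
    (h : (i, j) ∈ S b (c b).2) : spikes 𝕜 M S c i j = M * trit 𝕜 (c b).1 := by
  unfold spikes
  rw [Finset.sum_eq_single b _ (by simp), if_pos h]
  intro b' _ hb
  rw [if_neg fun h' => hb (hdisj _ _ _ _ _ h' h).1]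

lemma norm_spikes_le (hM : 0 ≤ M) (c : B → Fin 3 × D) (i : Fin N₁) (j : Fin N₂) :
    ‖spikes 𝕜 M S c i j‖ ≤ M := by
  by_cases h : ∃ b, (i, j) ∈ S b (c b).2
  · obtain ⟨b, hb⟩ := h
    rw [spikes_of_mem hdisj c b i j hb, norm_mul, RCLike.norm_ofReal, abs_of_nonneg hM]
    exact mul_le_of_le_one_right hM (norm_trit_le _)
  · push Not at h
    simpa [spikes, h] using hM

end

variable [DecidableEq B]

lemma spikes_update_of_notMem (c : B → Fin 3 × D) (b : B) (s s' : Fin 3) (d : D) (i : Fin N₁)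
    (j : Fin N₂) (h : (i, j) ∉ S b d) :
    spikes 𝕜 M S (Function.update c b (s, d)) i j =
      spikes 𝕜 M S (Function.update c b (s', d)) i j := by
  refine Finset.sum_congr rfl fun b' _ => ?_
  by_cases hb : b' = b
  · subst hb; simp [h]
  · simp [hb]

/-- The reason for admitting the sign `0`: it erases the position of the block, so the run on this
input is a reference run that carries no information on `d`. -/
lemma spikes_update_zero (c : B → Fin 3 × D) (b : B) (d d' : D) :
    spikes 𝕜 M S (Function.update c b (0, d)) = spikes 𝕜 M S (Function.update c b (0, d')) := by
  funext i j
  refine Finset.sum_congr rfl fun b' _ => ?_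
  by_cases hb : b' = b
  · subst hb; simp [trit]
  · simp [hb]

variable (hne : ∀ b d, (S b d).Nonempty) (hM : 0 ≤ M)
  (hF : ∀ c, mixedNorm p u (spikes 𝕜 M S c) ≤ 1)
  (A : DetAlgorithm (approxProblem 𝕜 p u q v N₁ N₂))
  (hfin : ∀ c, A.card ⟨spikes 𝕜 M S c, hF c⟩ ≠ ⊤)
include hdisj hne hM hfin

/-- If the reference run misses `S b d`, the inputs with signs `1` and `-1` there agree with the
reference on everything seen, so both get its output, and the triangle inequality gives `2 * M` at
each point of `S b d`. Otherwise the last term alone is at least `2 * M`. -/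
lemma meanOn_spikes_flip (c : B → Fin 3 × D) (b : B) (d : D) :
    2 * M ≤ meanOn (S b d) (spikes 𝕜 M S (Function.update c b (1, d)) -
          A.output ⟨spikes 𝕜 M S (Function.update c b (1, d)), hF _⟩) +
        meanOn (S b d) (spikes 𝕜 M S (Function.update c b (2, d)) -
          A.output ⟨spikes 𝕜 M S (Function.update c b (2, d)), hF _⟩) +
      2 * M *
        (A.seen ⟨spikes 𝕜 M S (Function.update c b (0, d)), hF _⟩ ∩ S b d).card := by
  rcases (A.seen ⟨spikes 𝕜 M S (Function.update c b (0, d)), hF _⟩ ∩ S b d).eq_empty_or_nonempty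
    with h | h
  · have key : ∀ s, A.output ⟨spikes 𝕜 M S (Function.update c b (s, d)), hF _⟩ =
        A.output ⟨spikes 𝕜 M S (Function.update c b (0, d)), hF _⟩ := fun s => by
      refine A.output_eq_of_eq_on_seen (hfin _) fun x hx => ?_
      exact spikes_update_of_notMem c b 0 s d _ _
        fun hxS => Finset.notMem_empty x (h ▸ Finset.mem_inter.2 ⟨hx, hxS⟩)
    rw [key 1, key 2, h]
    set a := A.output ⟨spikes 𝕜 M S (Function.update c b (0, d)), hF _⟩
    have hc : (0 : ℝ) < (S b d).card := by exact_mod_cast (hne b d).card_pos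
    unfold meanOn
    rw [← mul_add, ← Finset.sum_add_distrib]
    simp only [Finset.card_empty, Nat.cast_zero, mul_zero, add_zero]
    rw [one_div, ← div_eq_inv_mul, le_div_iff₀' hc, ← nsmul_eq_mul]
    refine Finset.card_nsmul_le_sum _ _ _ fun x hx => ?_
    simp only [Pi.sub_apply]
    rw [spikes_of_mem hdisj _ b x.1 x.2 (by simpa using hx),
      spikes_of_mem hdisj _ b x.1 x.2 (by simpa using hx)]
    simp only [Function.update_self, trit, Matrix.cons_val_one, Matrix.cons_val, Matrix.cons_val_zero]
    calc 2 * M = ‖((M : 𝕜) * 1 - a x.1 x.2) - ((M : 𝕜) * (-1) - a x.1 x.2)‖ := by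
          rw [show ((M : 𝕜) * 1 - a x.1 x.2) - ((M : 𝕜) * (-1) - a x.1 x.2) = ((2 * M : ℝ) : 𝕜) by
            push_cast; ring, RCLike.norm_ofReal, abs_of_nonneg (by positivity)]
      _ ≤ _ := norm_sub_le _ _
  · have h1 : (1 : ℝ) ≤
        (A.seen ⟨spikes 𝕜 M S (Function.update c b (0, d)), hF _⟩ ∩ S b d).card := by
      exact_mod_cast h.card_pos
    have h2 := meanOn_nonneg (S b d) (spikes 𝕜 M S (Function.update c b (1, d)) -
          A.output ⟨spikes 𝕜 M S (Function.update c b (1, d)), hF _⟩)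
    have h3 := meanOn_nonneg (S b d) (spikes 𝕜 M S (Function.update c b (2, d)) -
          A.output ⟨spikes 𝕜 M S (Function.update c b (2, d)), hF _⟩)
    nlinarith

variable [Fintype D] [Nonempty D]

/-- Sum `meanOn_spikes_flip` over the positions `d` and then over all configurations. The single
reference run pays for all the disjoint sets `S b d` at once, which produces the factor `1 /
Fintype.card D` in the cost term. -/
lemma sum_meanOn_spikes (b : B) :
    2 * M / 3 * Fintype.card (B → Fin 3 × D) ≤
      (∑ c, meanOn (S b (c b).2) (spikes 𝕜 M S c - A.output ⟨spikes 𝕜 M S c, hF c⟩)) +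
      2 * M / Fintype.card D *
        ∑ c, ((A.seen ⟨spikes 𝕜 M S c, hF c⟩ ∩ Finset.univ.biUnion (S b)).card : ℝ) := by
  obtain ⟨d₀⟩ := ‹Nonempty D›
  have hD : (0 : ℝ) < Fintype.card D := by exact_mod_cast Fintype.card_pos_iff.2 ⟨d₀⟩
  set E : (B → Fin 3 × D) → ℝ := fun c =>
    meanOn (S b (c b).2) (spikes 𝕜 M S c - A.output ⟨spikes 𝕜 M S c, hF c⟩) with hE
  set W : (B → Fin 3 × D) → ℝ := fun c =>
    ((A.seen ⟨spikes 𝕜 M S c, hF c⟩ ∩ Finset.univ.biUnion (S b)).card : ℝ) with hW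
  have hcard : (Fintype.card (Fin 3 × D) : ℝ) = 3 * Fintype.card D := by simp
  have hE0 : ∀ c, 0 ≤ E c := fun c => meanOn_nonneg _ _
  have hW0 : ∀ c, 0 ≤ W c := fun c => Nat.cast_nonneg _
  have hWd : ∀ c d d', W (Function.update c b (0, d)) = W (Function.update c b (0, d')) := by
    intro c d d'
    simp only [hW, spikes_update_zero c b d d']
  have h1 : ∀ c, 2 * M * Fintype.card D ≤ (∑ x, E (Function.update c b x)) +
      2 * M * W (Function.update c b (0, d₀)) := by
    intro c
    -- The reference run is the same for all `d`, and the sets `S b d` are disjoint, so its hits add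
    -- up to hits in their union.
    have hsum : ∑ d : D, ((A.seen ⟨spikes 𝕜 M S (Function.update c b (0, d)), hF _⟩ ∩
        S b d).card : ℝ) ≤ W (Function.update c b (0, d₀)) := by
      simp only [hW]
      rw [Finset.inter_biUnion, Finset.card_biUnion, Nat.cast_sum]
      · refine Finset.sum_le_sum fun d _ => le_of_eq ?_
        simp only [spikes_update_zero c b d d₀]
      · intro d _ d' _ hdd
        refine Finset.disjoint_left.2 fun x hx hx' => hdd ?_
        exact (hdisj _ _ _ _ x (Finset.mem_inter.1 hx).2 (Finset.mem_inter.1 hx').2).2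
    have hflip : ∑ d : D, 2 * M ≤ ∑ d : D, (E (Function.update c b (1, d)) +
        E (Function.update c b (2, d)) + 2 * M *
        (A.seen ⟨spikes 𝕜 M S (Function.update c b (0, d)), hF _⟩ ∩ S b d).card) := by
      refine Finset.sum_le_sum fun d _ => ?_
      have := meanOn_spikes_flip hdisj hne hM hF A hfin c b d
      simpa [hE] using this
    have hle : ∑ d : D, (E (Function.update c b (1, d)) + E (Function.update c b (2, d))) ≤
        ∑ x, E (Function.update c b x) := by
      rw [Fintype.sum_prod_type, Fin.sum_univ_three, Finset.sum_add_distrib]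
      have := Finset.sum_nonneg fun d (_ : d ∈ Finset.univ) => hE0 (Function.update c b (0, d))
      linarith
    rw [Finset.sum_add_distrib] at hflip
    simp only [← Finset.mul_sum, Finset.sum_const, Finset.card_univ, nsmul_eq_mul] at hflip
    have := mul_le_mul_of_nonneg_left hsum (show 0 ≤ 2 * M by positivity)
    linarith
  -- The sign of block `b` is zero in a third of all configurations, so the reference cost is at
  -- most three times the average cost.
  have h2 : ∑ c, W (Function.update c b (0, d₀)) ≤ 3 * ∑ c, W c := by
    have e := sum_sum_update b W
    have : ∑ c, (Fintype.card D : ℝ) * W (Function.update c b (0, d₀)) ≤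
        ∑ c, ∑ x, W (Function.update c b x) := by
      refine Finset.sum_le_sum fun c _ => ?_
      rw [Fintype.sum_prod_type, Fin.sum_univ_three]
      have e0 : ∑ d, W (Function.update c b (0, d)) =
          Fintype.card D * W (Function.update c b (0, d₀)) := by
        rw [Finset.sum_congr rfl fun d _ => hWd c d d₀]; simp
      have e1 := Finset.sum_nonneg fun d (_ : d ∈ Finset.univ) => hW0 (Function.update c b (1, d))
      have e2 := Finset.sum_nonneg fun d (_ : d ∈ Finset.univ) => hW0 (Function.update c b (2, d))
      linarith
    rw [e, hcard, ← Finset.mul_sum] at this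
    have h3 : (Fintype.card D : ℝ) * ∑ c, W (Function.update c b (0, d₀)) ≤
      Fintype.card D * (3 * ∑ c, W c) := by linarith
    exact le_of_mul_le_mul_left h3 hD
  have h3 := Finset.sum_le_sum fun c (_ : c ∈ Finset.univ) => h1 c
  rw [Finset.sum_add_distrib, sum_sum_update b E, hcard] at h3
  simp only [← Finset.mul_sum, Finset.sum_const, Finset.card_univ, nsmul_eq_mul] at h3
  have h4 := mul_le_mul_of_nonneg_left h2 (show 0 ≤ 2 * M by positivity)
  have h5 : (3 * Fintype.card D) * (2 * M / 3 * Fintype.card (B → Fin 3 × D)) ≤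
      (3 * Fintype.card D) * ((∑ c, E c) + 2 * M / Fintype.card D * ∑ c, W c) := by
    have : (3 * Fintype.card D : ℝ) * (2 * M / Fintype.card D * ∑ c, W c) =
        2 * M * (3 * ∑ c, W c) := by field_simp
    rw [mul_add, this]
    linarith
  exact le_of_mul_le_mul_left h5 (by positivity)

/-- The average error of a deterministic algorithm over the inputs `spikes`. -/
lemma sum_error_spikes [Nonempty B] {κ : ℝ} (hκ : 0 ≤ κ)
    (hG : ∀ (c : B → Fin 3 × D) (g : Fin N₁ → Fin N₂ → 𝕜),
      κ * ((1 / (Fintype.card B : ℝ)) * ∑ b, meanOn (S b (c b).2) g) ≤ mixedNorm q v g) :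
    2 * M * κ / 3 * Fintype.card (B → Fin 3 × D) ≤
      (∑ c, mixedNorm q v (spikes 𝕜 M S c - A.output ⟨spikes 𝕜 M S c, hF c⟩)) +
      2 * M * κ / (Fintype.card B * Fintype.card D) *
        ∑ c, ((A.seen ⟨spikes 𝕜 M S c, hF c⟩ ∩
          Finset.univ.biUnion fun b => Finset.univ.biUnion (S b)).card : ℝ) := by
  have hB : (0 : ℝ) < Fintype.card B := by exact_mod_cast Fintype.card_pos
  have h1 := Finset.sum_le_sum fun b (_ : b ∈ (Finset.univ : Finset B)) =>
    sum_meanOn_spikes hdisj hne hM hF A hfin b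
  rw [Finset.sum_add_distrib, Finset.sum_comm] at h1
  have h2 : ∀ c, ∑ b, ((A.seen ⟨spikes 𝕜 M S c, hF c⟩ ∩
      Finset.univ.biUnion (S b)).card : ℝ) = ((A.seen ⟨spikes 𝕜 M S c, hF c⟩ ∩
          Finset.univ.biUnion fun b => Finset.univ.biUnion (S b)).card : ℝ) := by
    intro c
    rw [Finset.inter_biUnion, Finset.card_biUnion, Nat.cast_sum]
    intro b _ b' _ hbb
    refine Finset.disjoint_left.2 fun x hx hx' => hbb ?_
    obtain ⟨d, _, hd⟩ := Finset.mem_biUnion.1 (Finset.mem_inter.1 hx).2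
    obtain ⟨d', _, hd'⟩ := Finset.mem_biUnion.1 (Finset.mem_inter.1 hx').2
    exact (hdisj _ _ _ _ x hd hd').1
  simp only [← Finset.mul_sum] at h1
  rw [Finset.sum_comm.trans (Finset.sum_congr rfl fun c _ => h2 c)] at h1
  simp only [Finset.sum_const, Finset.card_univ, nsmul_eq_mul] at h1
  have h3 := Finset.sum_le_sum fun c (_ : c ∈ (Finset.univ : Finset (B → Fin 3 × D))) =>
    hG c (spikes 𝕜 M S c - A.output ⟨spikes 𝕜 M S c, hF c⟩)
  rw [← Finset.mul_sum, ← Finset.mul_sum] at h3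
  have h4 := mul_le_mul_of_nonneg_left h1 (show 0 ≤ κ / Fintype.card B by positivity)
  refine le_trans (le_of_eq ?_) (h4.trans ?_)
  · field_simp
  · rw [mul_add]
    refine add_le_add (le_trans (le_of_eq ?_) h3) (le_of_eq ?_)
    · ring
    · field_simp

end Spikes

/-! ### From average error to randomized lower bounds -/

section LowerBound

variable {𝕜 : Type*} [RCLike 𝕜] [MeasurableSpace 𝕜] [BorelSpace 𝕜] {p q u v : ℝ≥0∞} {N₁ N₂ : ℕ}

open MeasureTheory in
/-- A lower bound for the mean error over finitely many inputs, valid for every deterministic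
algorithm, is one for the error of randomized algorithms. -/
lemma le_error_of_forall_le_mean {ι : Type*} [Fintype ι] [Nonempty ι]
    (f : ι → MixedBall 𝕜 p u N₁ N₂) {n : ℕ}
    (A : RanAlgorithm.{w} (approxProblem 𝕜 p u q v N₁ N₂)) (hA : A.HasCardLE n) {a K : ℝ}
    (hK : 0 < K)
    (h : ∀ ω, (∀ i, (A.alg ω).card (f i) ≠ ⊤) → a * Fintype.card ι ≤
      (∑ i, mixedNorm q v ((f i).1 - (A.alg ω).output (f i))) +
        K * ∑ i, (((A.alg ω).card (f i)).toNat : ℝ)) :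
    ENNReal.ofReal (a - K * n) ≤ A.error := by
  have hmeas : ∀ i, Measurable fun ω =>
      ENNReal.ofReal (mixedNorm q v ((f i).1 - (A.alg ω).output (f i))) := fun i =>
    ((measurable_mixedNorm q v N₁ N₂).comp
      ((measurable_const (a := (f i).1)).sub (hA.measurable_output (f i)))).ennreal_ofReal
  have hmeasc : ∀ i, Measurable fun ω => ((A.alg ω).card (f i) : ℝ≥0∞) := fun i =>
    (Measurable.of_discrete (f := fun m : ℕ∞ => (m : ℝ≥0∞))).comp (hA.measurable_card (f i))
  have hpt : ∀ ω, ENNReal.ofReal (a * Fintype.card ι) ≤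
      (∑ i, ENNReal.ofReal (mixedNorm q v ((f i).1 - (A.alg ω).output (f i)))) +
        ENNReal.ofReal K * ∑ i, ((A.alg ω).card (f i) : ℝ≥0∞) := by
    intro ω
    by_cases hfin : ∀ i, (A.alg ω).card (f i) ≠ ⊤
    · have h1 := ENNReal.ofReal_le_ofReal (h ω hfin)
      rw [ENNReal.ofReal_add (Finset.sum_nonneg fun i _ => mixedNorm_nonneg _ _ _) (by positivity),
        ENNReal.ofReal_sum_of_nonneg fun i _ => mixedNorm_nonneg _ _ _,
        ENNReal.ofReal_mul hK.le, ENNReal.ofReal_sum_of_nonneg fun i _ => Nat.cast_nonneg _] at h1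
      refine h1.trans (le_of_eq ?_)
      congr 2
      refine Finset.sum_congr rfl fun i _ => ?_
      rw [ENNReal.ofReal_natCast]
      conv_rhs => rw [← ENat.natCast_toNat (hfin i)]
      simp
    -- If some run does not stop, the cost term is infinite because `K` is positive, and the
    -- inequality is trivial.
    · push Not at hfin
      obtain ⟨i, hi⟩ := hfin
      have : ∑ i, ((A.alg ω).card (f i) : ℝ≥0∞) = ⊤ :=
        ENNReal.sum_eq_top.2 ⟨i, Finset.mem_univ _, by rw [hi]; rfl⟩
      rw [this, ENNReal.mul_top (by simpa using hK)]
      simp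
  have hint := lintegral_mono (μ := A.ℙ) hpt
  rw [lintegral_const, measure_univ, mul_one,
    lintegral_add_left (Finset.measurable_fun_sum _ fun i _ => hmeas i),
    lintegral_finsetSum _ fun i _ => hmeas i,
    lintegral_const_mul _ (Finset.measurable_fun_sum _ fun i _ => hmeasc i),
    lintegral_finsetSum _ fun i _ => hmeasc i] at hint
  have h1 : ∑ i, ∫⁻ ω, ENNReal.ofReal (mixedNorm q v ((f i).1 - (A.alg ω).output (f i))) ∂A.ℙ ≤
      Fintype.card ι * A.error := by
    refine (Finset.sum_le_card_nsmul _ _ A.error fun i _ => ?_).trans (by simp)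
    exact le_iSup (fun f : MixedBall 𝕜 p u N₁ N₂ => ∫⁻ ω, ENNReal.ofReal
      ((approxProblem 𝕜 p u q v N₁ N₂).gnorm
        ((approxProblem 𝕜 p u q v N₁ N₂).S f - (A.alg ω).output f)) ∂A.ℙ) (f i)
  have h2 : ∑ i, ∫⁻ ω, ((A.alg ω).card (f i) : ℝ≥0∞) ∂A.ℙ ≤ Fintype.card ι * (n : ℝ≥0∞) :=
    (Finset.sum_le_card_nsmul _ _ (n : ℝ≥0∞) fun i _ => hA.expected_card_le (f i)).trans (by simp)
  have h3 := hint.trans (add_le_add h1 (mul_le_mul_right h2 (ENNReal.ofReal K)))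
  have hι : (0 : ℝ) < Fintype.card ι := by exact_mod_cast Fintype.card_pos
  by_cases htop : A.error = ⊤
  · rw [htop]; exact le_top
  · rw [ENNReal.ofReal_le_iff_le_toReal htop]
    have h4 := ENNReal.toReal_mono (by finiteness) h3
    rw [ENNReal.toReal_add (by finiteness) (by finiteness)] at h4
    simp only [ENNReal.toReal_mul, ENNReal.toReal_natCast, ENNReal.toReal_ofReal hK.le] at h4
    have h5 := (ENNReal.ofReal_le_iff_le_toReal (by finiteness)).1 (le_refl (ENNReal.ofReal (a * Fintype.card ι)))
    have h6 : Fintype.card ι * (a - K * n) ≤ Fintype.card ι * A.error.toReal := by nlinarith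
    exact le_of_mul_le_mul_left h6 hι

variable {B D : Type*} [Fintype B] [DecidableEq B] [Fintype D] [Nonempty B] [Nonempty D]
  {M κ : ℝ} {S : B → D → Finset (Fin N₁ × Fin N₂)}

/-- The hypothesis `6 * n ≤ Fintype.card B * Fintype.card D` makes the cost term at most half of the
main term `2 * M * κ / 3`. -/
lemma le_eRan_of_spikes (hdisj : ∀ b d b' d' x, x ∈ S b d → x ∈ S b' d' → b = b' ∧ d = d')
    (hne : ∀ b d, (S b d).Nonempty) (hM : 0 < M) (hκ : 0 < κ)
    (hF : ∀ c, mixedNorm p u (spikes 𝕜 M S c) ≤ 1)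
    (hG : ∀ (c : B → Fin 3 × D) (g : Fin N₁ → Fin N₂ → 𝕜),
      κ * ((1 / (Fintype.card B : ℝ)) * ∑ b, meanOn (S b (c b).2) g) ≤ mixedNorm q v g)
    {n : ℕ} (hn : 6 * n ≤ Fintype.card B * Fintype.card D) :
    ENNReal.ofReal (M * κ / 3) ≤ eRan.{w} (approxProblem 𝕜 p u q v N₁ N₂) n := by
  have hB : (0 : ℝ) < Fintype.card B := by exact_mod_cast Fintype.card_pos
  have hD : (0 : ℝ) < Fintype.card D := by exact_mod_cast Fintype.card_pos
  refine le_iInf₂ fun A hA => ?_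
  refine le_trans (ENNReal.ofReal_le_ofReal ?_) (le_error_of_forall_le_mean
    (fun c : B → Fin 3 × D => ⟨spikes 𝕜 M S c, hF c⟩) A hA (a := 2 * M * κ / 3)
    (K := 2 * M * κ / (Fintype.card B * Fintype.card D)) (by positivity) fun ω hfin => ?_)
  · have hn' : (6 * n : ℝ) ≤ Fintype.card B * Fintype.card D := by exact_mod_cast hn
    have : 2 * M * κ / (Fintype.card B * Fintype.card D) * n ≤ M * κ / 3 := by
      rw [div_mul_eq_mul_div, div_le_iff₀ (by positivity)]
      have := mul_le_mul_of_nonneg_left hn' (show 0 ≤ M * κ / 3 by positivity)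
      linarith
    linarith
  · refine (sum_error_spikes hdisj hne hM.le hF (A.alg ω) hfin hκ.le hG).trans ?_
    gcongr with c
    exact_mod_cast (Finset.card_le_card Finset.inter_subset_left).trans
      ((A.alg ω).card_seen_le _)

end LowerBound

/-! ### Spikes of rectangular shape -/

section Shapes

variable {𝕜 : Type*} [RCLike 𝕜] {p q u v : ℝ≥0∞} {N₁ N₂ : ℕ}
  {B D : Type*} [Fintype B]
  {S : B → D → Finset (Fin N₁ × Fin N₂)} {t r s : ℕ}

/-- For every choice of `d`, the union of the sets `S b (d b)` consists of `s` points in each of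
`r` rows. -/
def HasShape (S : B → D → Finset (Fin N₁ × Fin N₂)) (r s : ℕ) : Prop :=
  ∀ d : B → D, ∃ (I : Finset (Fin N₁)) (T : Fin N₁ → Finset (Fin N₂)), I.card = r ∧
    (∀ i ∈ I, (T i).card = s) ∧ ∀ i j, (∃ b, (i, j) ∈ S b (d b)) ↔ i ∈ I ∧ j ∈ T i

/-- The height at which the functions supported on `s` points in each of `r` rows are in the
unit ball. -/
noncomputable def height (p u : ℝ≥0∞) (N₁ N₂ r s : ℕ) : ℝ :=
  (((r : ℝ) / N₁) ^ (p⁻¹).toReal * ((s : ℝ) / N₂) ^ (u⁻¹).toReal)⁻¹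

lemma height_pos (p u : ℝ≥0∞) (hN₁ : 1 ≤ N₁) (hN₂ : 1 ≤ N₂) (hr : 1 ≤ r) (hs : 1 ≤ s) :
    0 < height p u N₁ N₂ r s := by
  have h1 : (0 : ℝ) < N₁ := by exact_mod_cast hN₁
  have h2 : (0 : ℝ) < N₂ := by exact_mod_cast hN₂
  have h3 : (0 : ℝ) < r := by exact_mod_cast hr
  have h4 : (0 : ℝ) < s := by exact_mod_cast hs
  unfold height
  positivity

lemma mixedNorm_spikes_le (hp : 1 ≤ p) (hu : 1 ≤ u) (hN₁ : 1 ≤ N₁) (hN₂ : 1 ≤ N₂) (hr : 1 ≤ r)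
    (hs : 1 ≤ s) (hdisj : ∀ b d b' d' x, x ∈ S b d → x ∈ S b' d' → b = b' ∧ d = d')
    (hS : HasShape S r s) (c : B → Fin 3 × D) :
    mixedNorm p u (spikes 𝕜 (height p u N₁ N₂ r s) S c) ≤ 1 := by
  obtain ⟨I, T, hI, hT, h⟩ := hS fun b => (c b).2
  have hM := height_pos p u hN₁ hN₂ hr hs
  refine (mixedNorm_le_of_support hp hu _ I T hT hM.le
    (fun i _ j _ => norm_spikes_le hdisj hM.le c i j) fun i j hij => ?_).trans (le_of_eq ?_)
  · rw [← h i j] at hij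
    push Not at hij
    simp [spikes, hij]
  · have hm : height p u N₁ N₂ r s ≠ 0 := hM.ne'
    unfold height at hm ⊢
    rw [hI, mul_assoc, mul_comm (((s : ℝ) / N₂) ^ (u⁻¹).toReal)]
    exact inv_mul_cancel₀ fun h => hm (by rw [h, inv_zero])

/-- All blocks have the same size `t`, so the mean over blocks of the block means is the mean over
their union, which has `s` points in each of `r` rows. -/
lemma mean_meanOn_le_mixedNorm [DecidableEq B] (hq : 1 ≤ q) (hv : 1 ≤ v) (hr : 1 ≤ r) (hs : 1 ≤ s)
    (hdisj : ∀ b d b' d' x, x ∈ S b d → x ∈ S b' d' → b = b' ∧ d = d')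
    (hcard : ∀ b d, (S b d).card = t) (hS : HasShape S r s) (c : B → Fin 3 × D)
    (g : Fin N₁ → Fin N₂ → 𝕜) :
    (((r : ℝ) / N₁) ^ (q⁻¹).toReal * ((s : ℝ) / N₂) ^ (v⁻¹).toReal) *
      ((1 / (Fintype.card B : ℝ)) * ∑ b, meanOn (S b (c b).2) g) ≤ mixedNorm q v g := by
  obtain ⟨I, T, hI, hT, h⟩ := hS fun b => (c b).2
  have hU : (Finset.univ.biUnion fun b => S b (c b).2) =
      (I.sigma T).map (Equiv.sigmaEquivProd _ _).toEmbedding := by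
    ext ⟨i, j⟩
    simp only [Finset.mem_biUnion, Finset.mem_univ, true_and, h i j, Finset.mem_map,
      Finset.mem_sigma]
    constructor
    · rintro hij; exact ⟨⟨i, j⟩, hij, rfl⟩
    · rintro ⟨⟨i', j'⟩, hij, e⟩
      obtain ⟨rfl, rfl⟩ := Prod.mk.inj e
      exact hij
  have hdis : Set.PairwiseDisjoint (↑(Finset.univ : Finset B)) fun b => S b (c b).2 := by
    intro b _ b' _ hbb
    exact Finset.disjoint_left.2 fun x hx hx' => hbb (hdisj _ _ _ _ x hx hx').1
  have hsum : ∀ F : Fin N₁ × Fin N₂ → ℝ,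
      ∑ b, ∑ x ∈ S b (c b).2, F x = ∑ i ∈ I, ∑ j ∈ T i, F (i, j) := by
    intro F
    rw [← Finset.sum_biUnion hdis, hU, Finset.sum_map, Finset.sum_sigma]
    rfl
  have hBt : (Fintype.card B : ℝ) * t = r * s := by
    have := hsum fun _ => 1
    simp only [Finset.sum_const, hcard, nsmul_eq_mul, mul_one, Finset.card_univ] at this
    rw [this, Finset.sum_congr rfl fun i hi => by rw [hT i hi]]
    simp [hI]
  have key := mean_le_mixedNorm hq hv g I (Finset.card_pos.1 (by omega)) T hs hT
  rw [hI] at key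
  refine le_trans (le_of_eq ?_) key
  congr 1
  unfold meanOn
  simp only [hcard]
  rw [← Finset.mul_sum, hsum, ← hBt, ← mul_assoc]
  congr 1
  rw [one_div_mul_one_div]

variable [MeasurableSpace 𝕜] [BorelSpace 𝕜] [DecidableEq B] [Fintype D] [Nonempty B] [Nonempty D]

lemma height_mul (hN₁ : 1 ≤ N₁) (hN₂ : 1 ≤ N₂) (hr : 1 ≤ r) (hs : 1 ≤ s) :
    height p u N₁ N₂ r s *
      (((r : ℝ) / N₁) ^ (q⁻¹).toReal * ((s : ℝ) / N₂) ^ (v⁻¹).toReal) =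
      ((r : ℝ) / N₁) ^ ((q⁻¹).toReal - (p⁻¹).toReal) *
        ((s : ℝ) / N₂) ^ ((v⁻¹).toReal - (u⁻¹).toReal) := by
  have h1 : (0 : ℝ) < N₁ := by exact_mod_cast hN₁
  have h2 : (0 : ℝ) < N₂ := by exact_mod_cast hN₂
  have h3 : (0 : ℝ) < r := by exact_mod_cast hr
  have h4 : (0 : ℝ) < s := by exact_mod_cast hs
  unfold height
  rw [Real.rpow_sub (by positivity), Real.rpow_sub (by positivity)]
  field_simp

/-- Up to the factor 1/3, the bound is the ratio of the target norm to the source norm of the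
indicator of a set with `s` points in each of `r` rows. Only the choice of supports remains in each
application. -/
lemma le_eRan_of_shape (hp : 1 ≤ p) (hq : 1 ≤ q) (hu : 1 ≤ u) (hv : 1 ≤ v) (hN₁ : 1 ≤ N₁)
    (hN₂ : 1 ≤ N₂) (hr : 1 ≤ r) (hs : 1 ≤ s) (ht : 1 ≤ t)
    (hdisj : ∀ b d b' d' x, x ∈ S b d → x ∈ S b' d' → b = b' ∧ d = d')
    (hcard : ∀ b d, (S b d).card = t) (hS : HasShape S r s)
    {n : ℕ} (hn : 6 * n ≤ Fintype.card B * Fintype.card D) :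
    ENNReal.ofReal (((r : ℝ) / N₁) ^ ((q⁻¹).toReal - (p⁻¹).toReal) *
        ((s : ℝ) / N₂) ^ ((v⁻¹).toReal - (u⁻¹).toReal) / 3) ≤
      eRan.{w} (approxProblem 𝕜 p u q v N₁ N₂) n := by
  have h1 : (0 : ℝ) < N₁ := by exact_mod_cast hN₁
  have h2 : (0 : ℝ) < N₂ := by exact_mod_cast hN₂
  have h3 : (0 : ℝ) < r := by exact_mod_cast hr
  have h4 : (0 : ℝ) < s := by exact_mod_cast hs
  rw [← height_mul hN₁ hN₂ hr hs]
  exact le_eRan_of_spikes hdisj (fun b d => Finset.card_pos.1 (by rw [hcard]; omega))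
    (height_pos p u hN₁ hN₂ hr hs) (by positivity)
    (mixedNorm_spikes_le hp hu hN₁ hN₂ hr hs hdisj hS)
    (mean_meanOn_le_mixedNorm hq hv hr hs hdisj hcard hS) hn

end Shapes

/-! ### The hard families of inputs -/

section Cases

variable {𝕜 : Type*} [RCLike 𝕜] [MeasurableSpace 𝕜] [BorelSpace 𝕜] {p q u v : ℝ≥0∞} {N₁ N₂ n : ℕ}

/-- Inputs taking random signs on the first `m` rows. -/
lemma le_eRan_of_rows (hp : 1 ≤ p) (hq : 1 ≤ q) (hu : 1 ≤ u) (hv : 1 ≤ v)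
    (hN₂ : 1 ≤ N₂) {m : ℕ} (hm : 1 ≤ m) (hmN : m ≤ N₁) (hn : 6 * n ≤ m * N₂) :
    ENNReal.ofReal (((m : ℝ) / N₁) ^ ((q⁻¹).toReal - (p⁻¹).toReal) / 3) ≤
      eRan.{w} (approxProblem 𝕜 p u q v N₁ N₂) n := by
  have : NeZero m := ⟨by omega⟩
  have : NeZero N₂ := ⟨by omega⟩
  have h2 : (N₂ : ℝ) ≠ 0 := by positivity
  have key := le_eRan_of_shape.{w} (𝕜 := 𝕜) (n := n) (B := Fin m × Fin N₂) (D := Unit)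
    (S := fun b _ => {(Fin.castLE hmN b.1, b.2)}) (t := 1) (r := m) (s := N₂) hp hq hu hv
    (hm.trans hmN) hN₂ hm hN₂ le_rfl ?_ (by simp) ?_ (by simpa using hn)
  · rw [div_self h2, Real.one_rpow, mul_one] at key
    exact key
  · rintro ⟨b, j⟩ _ ⟨b', j'⟩ _ x hx hx'
    rw [Finset.mem_singleton] at hx hx'
    rw [hx] at hx'
    simp only [Prod.mk.injEq, Fin.castLE_inj] at hx'
    simp [hx'.1, hx'.2]
  · intro d
    refine ⟨Finset.univ.map (Fin.castLEEmb hmN), fun _ => Finset.univ, by simp, by simp,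
      fun i j => ?_⟩
    simp only [Finset.mem_singleton, Prod.mk.injEq, Prod.exists, Finset.mem_map, Finset.mem_univ,
      true_and, and_true]
    constructor
    · rintro ⟨a, b, rfl, rfl⟩; exact ⟨a, rfl⟩
    · rintro ⟨a, rfl⟩; exact ⟨a, j, rfl, rfl⟩

/-- Inputs with a single random spike in each row. -/
lemma le_eRan_of_columns (hp : 1 ≤ p) (hq : 1 ≤ q) (hu : 1 ≤ u) (hv : 1 ≤ v) (hN₁ : 1 ≤ N₁)
    (hN₂ : 1 ≤ N₂) (hn : 6 * n ≤ N₁ * N₂) :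
    ENNReal.ofReal ((N₂ : ℝ) ^ ((u⁻¹).toReal - (v⁻¹).toReal) / 3) ≤
      eRan.{w} (approxProblem 𝕜 p u q v N₁ N₂) n := by
  have : NeZero N₁ := ⟨by omega⟩
  have : NeZero N₂ := ⟨by omega⟩
  have h1 : (N₁ : ℝ) ≠ 0 := by positivity
  have key := le_eRan_of_shape.{w} (𝕜 := 𝕜) (n := n) (B := Fin N₁) (D := Fin N₂)
    (S := fun i j => {(i, j)}) (t := 1) (r := N₁) (s := 1) hp hq hu hv
    hN₁ hN₂ hN₁ le_rfl le_rfl ?_ (by simp) ?_ (by simpa using hn)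
  · rw [div_self h1, Real.one_rpow, one_mul, Nat.cast_one, one_div, Real.inv_rpow (by positivity),
      ← Real.rpow_neg (by positivity), neg_sub] at key
    exact key
  · intro b d b' d' x hx hx'
    simp_all
  · intro d
    refine ⟨Finset.univ, fun i => {d i}, by simp, by simp, fun i j => ?_⟩
    simp [Prod.ext_iff]

/-- Inputs supported on a random class modulo `k` of a random row. -/
lemma le_eRan_of_residues (hp : 1 ≤ p) (hq : 1 ≤ q) (hu : 1 ≤ u) (hv : 1 ≤ v) (hN₁ : 1 ≤ N₁)
    {k : ℕ} (hk : 1 ≤ k) (hkN : k ≤ N₂) (hn : 6 * n ≤ N₁ * k) :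
    ENNReal.ofReal ((N₁ : ℝ) ^ ((p⁻¹).toReal - (q⁻¹).toReal) *
      (k : ℝ) ^ ((u⁻¹).toReal - (v⁻¹).toReal) / 6) ≤
      eRan.{w} (approxProblem 𝕜 p u q v N₁ N₂) n := by
  have : NeZero N₁ := ⟨by omega⟩
  have : NeZero k := ⟨by omega⟩
  have h1 : (0 : ℝ) < N₁ := by positivity
  have hk0 : (0 : ℝ) < k := by positivity
  -- Each residue class is cut down to exactly `m` columns `r + k * l`; the remaining columns are
  -- not used. Since `N₂ ≤ 2 * k * m`, rounding costs a factor at most 2, whence 6 in place of 3.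
  set m := N₂ / k with hm
  have hm1 : 1 ≤ m := (Nat.one_le_div_iff (by omega)).2 hkN
  have hmk : k * m ≤ N₂ := Nat.mul_div_le _ _
  have hbound : ∀ (r : Fin k) (l : Fin m), (r : ℕ) + k * l < N₂ := fun r l => by
    have h1 := r.2
    have h2 : k * (l + 1) ≤ k * m := Nat.mul_le_mul_left _ l.2
    nlinarith
  have hinj : ∀ (r r' : Fin k) (l l' : Fin m), (r : ℕ) + k * l = r' + k * l' → r = r' ∧ l = l' := by
    intro r r' l l' h
    have h1 : (r : ℕ) = r' := by
      have := congrArg (· % k) h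
      simpa [Nat.add_mul_mod_self_left, Nat.mod_eq_of_lt r.2, Nat.mod_eq_of_lt r'.2] using this
    refine ⟨Fin.ext h1, Fin.ext ?_⟩
    rw [h1] at h
    exact Nat.eq_of_mul_eq_mul_left (by omega) (Nat.add_left_cancel h)
  let T : Fin k → Finset (Fin N₂) := fun r =>
    Finset.univ.image fun l : Fin m => ⟨(r : ℕ) + k * l, hbound r l⟩
  have hT : ∀ r, (T r).card = m := fun r => by
    rw [Finset.card_image_of_injective _ fun l l' h => (hinj r r l l' (by simpa using h)).2]
    simp
  have hTdisj : ∀ r r' j, j ∈ T r → j ∈ T r' → r = r' := by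
    intro r r' j h h'
    obtain ⟨l, _, rfl⟩ := Finset.mem_image.1 h
    obtain ⟨l', _, e⟩ := Finset.mem_image.1 h'
    exact (hinj r' r l' l (by simpa using e)).1.symm
  have key := le_eRan_of_shape.{w} (𝕜 := 𝕜) (n := n) (B := Unit) (D := Fin N₁ × Fin k)
    (S := fun _ d => {d.1} ×ˢ T d.2) (t := m) (r := 1) (s := m) hp hq hu hv
    hN₁ (hk.trans hkN) le_rfl hm1 hm1 ?_ (by simp [hT]) ?_ (by simpa using hn)
  · refine le_trans (ENNReal.ofReal_le_ofReal ?_) key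
    have e : ((1 : ℕ) / (N₁ : ℝ)) ^ ((q⁻¹).toReal - (p⁻¹).toReal) =
        (N₁ : ℝ) ^ ((p⁻¹).toReal - (q⁻¹).toReal) := by
      rw [Nat.cast_one, one_div, Real.inv_rpow h1.le, ← Real.rpow_neg h1.le, neg_sub]
    rw [e]
    suffices (k : ℝ) ^ ((u⁻¹).toReal - (v⁻¹).toReal) ≤
        2 * ((m : ℝ) / N₂) ^ ((v⁻¹).toReal - (u⁻¹).toReal) by
      have h0 : 0 ≤ (N₁ : ℝ) ^ ((p⁻¹).toReal - (q⁻¹).toReal) := by positivity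
      have := mul_le_mul_of_nonneg_left this h0
      linarith
    have hm0 : (0 : ℝ) < m := by exact_mod_cast hm1
    have hN0 : (0 : ℝ) < N₂ := by exact_mod_cast hk.trans hkN
    have hmk' : (k : ℝ) * m ≤ N₂ := by exact_mod_cast hmk
    have hmk2 : (N₂ : ℝ) ≤ 2 * k * m := by
      have : N₂ < k * (m + 1) := Nat.lt_mul_div_succ _ (by omega)
      have h3 : N₂ ≤ 2 * k * m := by nlinarith
      exact_mod_cast h3
    have hk' : (k : ℝ) ^ ((u⁻¹).toReal - (v⁻¹).toReal) =
        (1 / (k : ℝ)) ^ ((v⁻¹).toReal - (u⁻¹).toReal) := by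
      rw [one_div, Real.inv_rpow hk0.le, ← Real.rpow_neg hk0.le, neg_sub]
    rw [hk']
    -- For a nonnegative exponent one needs `N₂ ≤ 2 * k * m`, and the factor 2 stays bounded because
    -- the exponent is at most 1; for a nonpositive one `k * m ≤ N₂` suffices.
    rcases le_total (u⁻¹).toReal (v⁻¹).toReal with h | h
    · have h2 : (2 : ℝ) ^ ((v⁻¹).toReal - (u⁻¹).toReal) ≤ 2 := by
        have := Real.rpow_le_rpow_of_exponent_le (one_le_two (α := ℝ))
          (show (v⁻¹).toReal - (u⁻¹).toReal ≤ 1 by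
            linarith [toReal_inv_le_one hv, ENNReal.toReal_nonneg (a := u⁻¹)])
        simpa using this
      calc (1 / (k : ℝ)) ^ ((v⁻¹).toReal - (u⁻¹).toReal)
          ≤ (2 * ((m : ℝ) / N₂)) ^ ((v⁻¹).toReal - (u⁻¹).toReal) := by
            refine Real.rpow_le_rpow (by positivity) ?_ (sub_nonneg.2 h)
            rw [← mul_div_assoc, div_le_div_iff₀ hk0 hN0]
            linarith
        _ ≤ _ := by
            rw [Real.mul_rpow (by norm_num) (by positivity)]
            gcongr
    · have h3 : (1 / (k : ℝ)) ^ ((v⁻¹).toReal - (u⁻¹).toReal) ≤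
          ((m : ℝ) / N₂) ^ ((v⁻¹).toReal - (u⁻¹).toReal) := by
        refine Real.rpow_le_rpow_of_nonpos (by positivity) ?_ (sub_nonpos.2 h)
        rw [div_le_div_iff₀ hN0 hk0]
        linarith
      have h4 : 0 ≤ ((m : ℝ) / N₂) ^ ((v⁻¹).toReal - (u⁻¹).toReal) := by positivity
      linarith
  · rintro _ ⟨i, r⟩ _ ⟨i', r'⟩ ⟨x, y⟩ hx hx'
    simp only [Finset.mem_product, Finset.mem_singleton] at hx hx'
    simp [← hx.1, hx'.1, hTdisj r r' y hx.2 hx'.2]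
  · intro d
    refine ⟨{(d ()).1}, fun _ => T (d ()).2, by simp, by simp [hT], fun i j => ?_⟩
    simp only [Finset.mem_product, Finset.mem_singleton]
    exact ⟨fun ⟨_, h⟩ => h, fun h => ⟨(), h⟩⟩

/-- Inputs taking random signs on a random row. -/
lemma le_eRanNon_of_row (hp : 1 ≤ p) (hq : 1 ≤ q) (hu : 1 ≤ u) (hv : 1 ≤ v) (hN₁ : 1 ≤ N₁)
    (hN₂ : 1 ≤ N₂) (hn : 6 * n ≤ N₁ * N₂) :
    ENNReal.ofReal ((N₁ : ℝ) ^ ((p⁻¹).toReal - (q⁻¹).toReal) / 3) ≤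
      eRanNon.{w} (approxProblem 𝕜 p u q v N₁ N₂) n := by
  have : NeZero N₁ := ⟨by omega⟩
  have : NeZero N₂ := ⟨by omega⟩
  have h1 : (0 : ℝ) < N₁ := by positivity
  have h2 : (0 : ℝ) < N₂ := by positivity
  let S : Fin N₁ → Fin N₂ → Unit → Finset (Fin N₁ × Fin N₂) := fun i j _ => {(i, j)}
  have hdisj : ∀ i, ∀ b d b' d' x, x ∈ S i b d → x ∈ S i b' d' → b = b' ∧ d = d' := by
    intro i b d b' d' x hx hx'
    simp_all [S]
  have hshape : ∀ i, HasShape (S i) 1 N₂ := by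
    intro i d
    refine ⟨{i}, fun _ => Finset.univ, by simp, by simp, fun i j => ?_⟩
    simp [S, Prod.ext_iff]
  have hcard : ∀ i b d, (S i b d).card = 1 := by simp [S]
  set M := height p u N₁ N₂ 1 N₂ with hMdef
  have hM : 0 < M := height_pos p u hN₁ hN₂ le_rfl hN₂
  set κ : ℝ := (((1 : ℕ) : ℝ) / N₁) ^ (q⁻¹).toReal * ((N₂ : ℝ) / N₂) ^ (v⁻¹).toReal with hκdef
  have hκ : 0 < κ := by positivity
  have hMκ : M * κ = (N₁ : ℝ) ^ ((p⁻¹).toReal - (q⁻¹).toReal) := by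
    rw [hMdef, hκdef, height_mul hN₁ hN₂ le_rfl hN₂, div_self h2.ne', Real.one_rpow, mul_one,
      Nat.cast_one, one_div, Real.inv_rpow h1.le, ← Real.rpow_neg h1.le, neg_sub]
  have hF : ∀ i c, mixedNorm p u (spikes 𝕜 M (S i) c) ≤ 1 := fun i =>
    mixedNorm_spikes_le hp hu hN₁ hN₂ le_rfl hN₂ (hdisj i) (hshape i)
  refine le_iInf₂ fun A hA => le_iInf fun hNon => ?_
  let f : Fin N₁ × (Fin N₂ → Fin 3 × Unit) → MixedBall 𝕜 p u N₁ N₂ :=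
    fun z => ⟨spikes 𝕜 M (S z.1) z.2, hF z.1 z.2⟩
  refine le_trans (ENNReal.ofReal_le_ofReal ?_) (le_error_of_forall_le_mean f A hA
    (a := 2 * M * κ / 3) (K := 2 * M * κ / (N₁ * N₂)) (by positivity) fun ω hfin => ?_)
  · have hn' : (6 * n : ℝ) ≤ N₁ * N₂ := by exact_mod_cast hn
    have : 2 * M * κ / (N₁ * N₂) * n ≤ M * κ / 3 := by
      rw [div_mul_eq_mul_div, div_le_iff₀ (by positivity)]
      have := mul_le_mul_of_nonneg_left hn' (show 0 ≤ M * κ / 3 by positivity)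
      linarith
    rw [← hMκ]
    linarith
  · set a := A.alg ω with ha
    let z₀ : Fin N₁ × (Fin N₂ → Fin 3 × Unit) := (0, fun _ => (0, ()))
    have hrow := fun i => sum_error_spikes (hdisj i)
      (fun b d => Finset.card_pos.1 (by rw [hcard i b d]; omega)) hM.le (hF i) a
      (fun c => hfin (i, c)) hκ.le
      (mean_meanOn_le_mixedNorm hq hv le_rfl hN₂ (hdisj i) (hcard i) (hshape i))
    -- Non-adaptivity enters here: the set of evaluated points depends neither on the hidden row nor
    -- on the signs.
    have hseen : ∀ z, a.seen (f z) = a.seen (f z₀) := fun z =>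
      a.seen_eq_of_isNonadaptive (hNon ω) _ _
    have hcd : ∀ z, a.card (f z) = a.card (f z₀) := fun z =>
      a.card_eq_of_isNonadaptive (hNon ω) _ _
    have hsum := Finset.sum_le_sum fun i (_ : i ∈ (Finset.univ : Finset (Fin N₁))) => hrow i
    rw [Finset.sum_add_distrib, ← Fintype.sum_prod_type' (f := fun i c => mixedNorm q v
      (spikes 𝕜 M (S i) c - a.output ⟨spikes 𝕜 M (S i) c, hF i c⟩))] at hsum
    -- For the hidden row `i` only the points seen in row `i` count. Over all `i` each seen point
    -- counts once, and averaging over the rows yields the factor `1 / N₁` in `K`.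
    have hQ : ∀ i, ∑ c, ((a.seen ⟨spikes 𝕜 M (S i) c, hF i c⟩ ∩
        Finset.univ.biUnion fun b => Finset.univ.biUnion (S i b)).card : ℝ) =
        Fintype.card (Fin N₂ → Fin 3 × Unit) *
          ((a.seen (f z₀)).filter fun x => x.1 = i).card := by
      intro i
      have : ∀ c ∈ (Finset.univ : Finset (Fin N₂ → Fin 3 × Unit)),
          ((a.seen ⟨spikes 𝕜 M (S i) c, hF i c⟩ ∩
          Finset.univ.biUnion fun b => Finset.univ.biUnion (S i b)).card : ℝ) =
          ((a.seen (f z₀)).filter fun x => x.1 = i).card := by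
        intro c _
        rw [← hseen (i, c)]
        congr 2
        ext ⟨x, y⟩
        simp [S, f, Prod.ext_iff, and_comm]
      rw [Finset.sum_congr rfl this]
      simp
    have hfib : ∑ i, (((a.seen (f z₀)).filter fun x => x.1 = i).card : ℝ) =
        (a.seen (f z₀)).card := by
      have := Finset.card_eq_sum_card_fiberwise (s := a.seen (f z₀)) (t := Finset.univ)
        (f := Prod.fst) (fun _ _ => by simp)
      exact_mod_cast this.symm
    simp only [hQ, ← Finset.mul_sum, hfib] at hsum
    have hle : ((a.seen (f z₀)).card : ℝ) ≤ ((a.card (f z₀)).toNat : ℝ) := by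
      exact_mod_cast a.card_seen_le _
    simp only [hcd]
    simp only [Finset.sum_const, Finset.card_univ, nsmul_eq_mul, Fintype.card_prod,
      Fintype.card_fin, Nat.cast_mul, Fintype.card_unit, Nat.cast_one, mul_one] at hsum ⊢
    refine le_trans (le_of_eq ?_) (hsum.trans (add_le_add le_rfl ?_))
    · ring
    · have h3 := mul_le_mul_of_nonneg_left hle
        (show 0 ≤ 2 * M * κ / N₂ * (Fintype.card (Fin N₂ → Fin 3 × Unit)) by positivity)
      rw [← mul_assoc]
      refine h3.trans (le_of_eq ?_)
      field_simp

end Cases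

/-! ### Uniform choice among finitely many algorithms -/

section UniformAlgorithm

variable {𝕜 : Type*} [RCLike 𝕜] {p q u v : ℝ≥0∞} {N₁ N₂ n : ℕ}

open MeasureTheory in
/-- The uniform random choice among finitely many deterministic algorithms. -/
noncomputable def uniformAlgorithm {ι : Type} [Fintype ι] [Nonempty ι]
    (a : ι → DetAlgorithm (approxProblem 𝕜 p u q v N₁ N₂)) :
    RanAlgorithm.{w} (approxProblem 𝕜 p u q v N₁ N₂) where
  Ω := ULift.{w} ι
  -- With the full σ-algebra on a finite set, all measurability conditions of `HasCardLE` are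
  -- trivial.
  mΩ := ⊤
  ℙ := (Fintype.card ι : ℝ≥0∞)⁻¹ • @Measure.count _ ⊤
  isProb := ⟨by
    let _ : MeasurableSpace (ULift.{w} ι) := ⊤
    rw [Measure.smul_apply, Measure.count_apply MeasurableSet.univ, smul_eq_mul]
    simpa using ENNReal.inv_mul_cancel (a := (Fintype.card ι : ℝ≥0∞)) (by simp) (by simp)⟩
  alg ω := a ω.down

variable {ι : Type} [Fintype ι] [Nonempty ι]
  (a : ι → DetAlgorithm (approxProblem 𝕜 p u q v N₁ N₂))

open MeasureTheory in
lemma lintegral_uniformAlgorithm (g : ι → ℝ≥0∞) :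
    ∫⁻ ω, g ω.down ∂(uniformAlgorithm.{w} a).ℙ = (Fintype.card ι : ℝ≥0∞)⁻¹ * ∑ i, g i := by
  let _ : MeasurableSpace (ULift.{w} ι) := ⊤
  change ∫⁻ ω : ULift.{w} ι, g ω.down ∂((Fintype.card ι : ℝ≥0∞)⁻¹ • Measure.count) = _
  rw [lintegral_smul_measure, lintegral_count, tsum_fintype, smul_eq_mul]
  congr 1
  exact Equiv.sum_comp Equiv.ulift g

lemma uniformAlgorithm_error_le {E : ℝ}
    (hE : ∀ f : MixedBall 𝕜 p u N₁ N₂,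
      ∑ i, mixedNorm q v (f.1 - (a i).output f) ≤ E * Fintype.card ι) :
    (uniformAlgorithm.{w} a).error ≤ ENNReal.ofReal E := by
  refine iSup_le fun f => ?_
  refine (lintegral_uniformAlgorithm a fun i =>
    ENNReal.ofReal (mixedNorm q v (f.1 - (a i).output f))).trans_le ?_
  rw [← ENNReal.div_eq_inv_mul]
  refine ENNReal.div_le_of_le_mul ?_
  rw [← ENNReal.ofReal_sum_of_nonneg fun i _ => mixedNorm_nonneg _ _ _,
    ← ENNReal.ofReal_natCast, ← ENNReal.ofReal_mul' (Nat.cast_nonneg _)]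
  exact ENNReal.ofReal_le_ofReal (hE f)

variable [MeasurableSpace 𝕜] [BorelSpace 𝕜]

lemma uniformAlgorithm_hasCardLE (m : ι → MixedBall 𝕜 p u N₁ N₂ → ℕ)
    (hm : ∀ i f, (a i).card f = m i f) (hn : ∀ f, ∑ i, m i f ≤ n * Fintype.card ι) :
    (uniformAlgorithm.{w} a).HasCardLE n := by
  refine ⟨fun f => fun _ _ => trivial, fun f => ?_, fun f => fun _ _ => trivial, fun f =>
    ⟨Set.range fun ω => ((uniformAlgorithm.{w} a).alg ω).output f, ?_, ?_⟩⟩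
  · refine (lintegral_uniformAlgorithm a fun i => (((a i).card f : ℕ∞) : ℝ≥0∞)).trans_le ?_
    simp only [hm]
    rw [← ENNReal.div_eq_inv_mul]
    refine ENNReal.div_le_of_le_mul ?_
    have := hn f
    simp only [ENat.toENNReal_coe]
    exact_mod_cast this
  · have : Finite (uniformAlgorithm.{w} a).Ω := inferInstanceAs (Finite (ULift.{w} ι))
    exact (Set.finite_range _).isSeparable
  · exact Filter.Eventually.of_forall fun ω => Set.mem_range_self ω

lemma eRan_le_error {A : RanAlgorithm.{w} (approxProblem 𝕜 p u q v N₁ N₂)}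
    (hA : A.HasCardLE n) : eRan.{w} (approxProblem 𝕜 p u q v N₁ N₂) n ≤ A.error :=
  iInf₂_le (f := fun (A : RanAlgorithm.{w} (approxProblem 𝕜 p u q v N₁ N₂))
    (_ : A.HasCardLE n) => A.error) A hA

lemma eRanNon_le_error {A : RanAlgorithm.{w} (approxProblem 𝕜 p u q v N₁ N₂)}
    (hA : A.HasCardLE n) (hN : A.IsNonadaptive) :
    eRanNon.{w} (approxProblem 𝕜 p u q v N₁ N₂) n ≤ A.error :=
  (iInf₂_le (f := fun (A : RanAlgorithm.{w} (approxProblem 𝕜 p u q v N₁ N₂))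
    (_ : A.HasCardLE n) => ⨅ (_ : A.IsNonadaptive), A.error) A hA).trans (iInf_le _ hN)

lemma eRan_le_of_uniform (m : ι → MixedBall 𝕜 p u N₁ N₂ → ℕ)
    (hm : ∀ i f, (a i).card f = m i f) (hn : ∀ f, ∑ i, m i f ≤ n * Fintype.card ι) {E : ℝ}
    (hE : ∀ f : MixedBall 𝕜 p u N₁ N₂,
      ∑ i, mixedNorm q v (f.1 - (a i).output f) ≤ E * Fintype.card ι) :
    eRan.{w} (approxProblem 𝕜 p u q v N₁ N₂) n ≤ ENNReal.ofReal E :=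
  (eRan_le_error (uniformAlgorithm_hasCardLE a m hm hn)).trans (uniformAlgorithm_error_le a hE)

lemma eRan_le_eRanNon :
    eRan.{w} (approxProblem 𝕜 p u q v N₁ N₂) n ≤
      eRanNon.{w} (approxProblem 𝕜 p u q v N₁ N₂) n :=
  le_iInf₂ fun _ hA => le_iInf fun _ => eRan_le_error hA

/-- The error of the algorithm which returns zero. -/
lemma eRanNon_le_embedding (hp : 1 ≤ p) (hq : 1 ≤ q) (hu : 1 ≤ u) (hv : 1 ≤ v) (hN₁ : 1 ≤ N₁)
    (hN₂ : 1 ≤ N₂) :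
    eRanNon.{w} (approxProblem 𝕜 p u q v N₁ N₂) n ≤
      ENNReal.ofReal ((N₁ : ℝ) ^ max ((p⁻¹).toReal - (q⁻¹).toReal) 0 *
        (N₂ : ℝ) ^ max ((u⁻¹).toReal - (v⁻¹).toReal) 0) := by
  let a : Unit → DetAlgorithm (approxProblem 𝕜 p u q v N₁ N₂) := fun _ =>
    { L := fun _ _ => ⟨_, (⟨0, by omega⟩, ⟨0, by omega⟩), rfl⟩
      τ := fun _ _ => true
      φ := fun _ _ => 0 }
  have hcard : ∀ i f, (a i).card f = (0 : ℕ) := fun i f =>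
    ((a i).card_eq_coe_iff f 0).2 ⟨rfl, fun m hm => absurd hm (by omega)⟩
  refine (eRanNon_le_error (uniformAlgorithm_hasCardLE a (fun _ _ => 0) hcard (by simp))
    fun ω i y z => ⟨rfl, rfl⟩).trans (uniformAlgorithm_error_le a fun f => ?_)
  have hout : (a ()).output f = 0 := rfl
  rw [Fintype.sum_unique, Fintype.card_unit, Nat.cast_one, mul_one]
  have h := mixedNorm_embedding hp hq hu hv hN₁ hN₂ f.1
  have h' := mul_le_mul_of_nonneg_left f.2
    (show 0 ≤ ((N₁ : ℝ) ^ max ((p⁻¹).toReal - (q⁻¹).toReal) 0 *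
        (N₂ : ℝ) ^ max ((u⁻¹).toReal - (v⁻¹).toReal) 0) by positivity)
  rw [mul_one] at h'
  change mixedNorm q v (f.1 - (a ()).output f) ≤ _
  rw [hout, sub_zero]
  exact h.trans h'

end UniformAlgorithm

/-! ### Two-stage deterministic algorithms -/

section TwoStage

variable {𝕜 : Type*} [RCLike 𝕜] {p q u v : ℝ≥0∞} {N₁ N₂ : ℕ}

/-- The function with values `y` along the list `l` of points and zero elsewhere. -/
noncomputable def recover (l : List (Fin N₁ × Fin N₂)) {i : ℕ} (y : Fin i → 𝕜) :
    Fin N₁ → Fin N₂ → 𝕜 :=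
  fun s t => if h : l.idxOf (s, t) < i then y ⟨_, h⟩ else 0

/-- The algorithm which evaluates the input along `l`, then along a list `sel` depending on the
values observed so far, and returns the known values of the input, extended by zero. -/
noncomputable def twoStage (x₀ : Fin N₁ × Fin N₂) (l : List (Fin N₁ × Fin N₂))
    (sel : (Fin N₁ → Fin N₂ → 𝕜) → List (Fin N₁ × Fin N₂)) :
    DetAlgorithm (approxProblem 𝕜 p u q v N₁ N₂) where
  -- For `i < l.length` the second list is computed from incomplete data. This is harmless: the
  -- entry at `i` still lies in `l`, and the total length exceeds `i`, so the algorithm does not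
  -- stop.
  L i y := ⟨_, (l ++ sel (recover l y)).getD i x₀, rfl⟩
  τ i y := decide (i = (l ++ sel (recover l y)).length)
  φ _ y := recover (l ++ sel (recover l y)) y

variable {x₀ : Fin N₁ × Fin N₂} {l : List (Fin N₁ × Fin N₂)}
  {sel : (Fin N₁ → Fin N₂ → 𝕜) → List (Fin N₁ × Fin N₂)}

lemma recover_of_mem (f : Fin N₁ → Fin N₂ → 𝕜) (l l' : List (Fin N₁ × Fin N₂)) {i : ℕ}
    (hi : l.length ≤ i) {s : Fin N₁} {t : Fin N₂} (h : (s, t) ∈ l) :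
    recover l (fun m : Fin i => f ((l ++ l').getD m x₀).1 ((l ++ l').getD m x₀).2) s t = f s t := by
  have h1 := List.idxOf_lt_length_of_mem h
  unfold recover
  rw [dif_pos (h1.trans_le hi)]
  have : (l ++ l').getD (l.idxOf (s, t)) x₀ = (s, t) := by
    rw [List.getD_append _ _ _ _ h1, List.getD_eq_getElem _ _ h1]
    exact List.getElem_idxOf h1
  simp only [this]

variable (hsel : ∀ f g : Fin N₁ → Fin N₂ → 𝕜, (∀ s t, (s, t) ∈ l → f s t = g s t) → sel f = sel g)
include hsel

lemma sel_recover (f : Fin N₁ → Fin N₂ → 𝕜) {i : ℕ} (hi : l.length ≤ i) :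
    sel (recover l (fun m : Fin i =>
      f ((l ++ sel f).getD m x₀).1 ((l ++ sel f).getD m x₀).2)) = sel f :=
  hsel _ _ fun _ _ h => recover_of_mem f l _ hi h

lemma twoStage_values (f : MixedBall 𝕜 p u N₁ N₂) (i : ℕ) :
    (twoStage (q := q) (v := v) x₀ l sel).values f i =
      fun m : Fin i => f.1 ((l ++ sel f.1).getD m x₀).1 ((l ++ sel f.1).getD m x₀).2 := by
  induction i with
  | zero => exact funext fun x => x.elim0
  | succ i ih =>
    rw [DetAlgorithm.values_succ, ih]
    have key : ∀ l' : List (Fin N₁ × Fin N₂), (l.length ≤ i → l' = sel f.1) →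
        (l ++ l').getD i x₀ = (l ++ sel f.1).getD i x₀ := by
      intro l' hl'
      rcases lt_or_ge i l.length with h | h
      · rw [List.getD_append _ _ _ _ h, List.getD_append _ _ _ _ h]
      · rw [hl' h]
    have := key _ fun h => sel_recover hsel f.1 (x₀ := x₀) h
    funext m
    refine Fin.lastCases ?_ (fun m => ?_) m
    · rw [Fin.snoc_last]
      change f.1 (_ : Fin N₁ × Fin N₂).1 (_ : Fin N₁ × Fin N₂).2 = _
      simp only [Fin.val_last]
      rw [← this]
    · rw [Fin.snoc_castSucc]
      rfl

lemma twoStage_card (f : MixedBall 𝕜 p u N₁ N₂) :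
    (twoStage (q := q) (v := v) x₀ l sel).card f = ((l ++ sel f.1).length : ℕ) := by
  rw [DetAlgorithm.card_eq_coe_iff]
  constructor
  · rw [twoStage_values hsel]
    simp only [twoStage, decide_eq_true_eq]
    rw [sel_recover hsel]
    simp
  · intro m hm
    rw [twoStage_values hsel]
    simp only [twoStage, ne_eq, decide_eq_true_eq]
    rcases lt_or_ge m l.length with h | h
    · rw [List.length_append]; omega
    · rw [sel_recover hsel _ h]; omega

lemma twoStage_output (f : MixedBall 𝕜 p u N₁ N₂) (s : Fin N₁) (t : Fin N₂) :
    (twoStage (q := q) (v := v) x₀ l sel).output f s t =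
      if (s, t) ∈ l ++ sel f.1 then f.1 s t else 0 := by
  rw [DetAlgorithm.output_of_card_eq _ (twoStage_card hsel f), twoStage_values hsel]
  simp only [twoStage]
  rw [sel_recover hsel _ (by simp)]
  split_ifs with h
  · have := recover_of_mem (x₀ := x₀) f.1 (l ++ sel f.1) [] le_rfl h
    simpa using this
  · unfold recover
    rw [dif_neg]
    rw [List.idxOf_eq_length h]
    simp

end TwoStage

/-! ### Tail bounds for empirical means -/

section Sampling

variable {N k : ℕ}

/-- Take the `a`-th power of e^(-z/a) ≤ a/z. It trades exponential decay for a power chosen to match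
the p-norm. -/
lemma exp_neg_le_rpow {z a : ℝ} (hz : 0 < z) (ha : 0 < a) : Real.exp (-z) ≤ (a / z) ^ a := by
  have h1 : Real.exp (-z) = Real.exp (-(z / a)) ^ a := by
    rw [← Real.exp_mul]; congr 1; field_simp
  rw [h1]
  refine Real.rpow_le_rpow (Real.exp_pos _).le ?_ ha.le
  rw [Real.exp_neg, ← inv_div z a]
  exact inv_anti₀ (by positivity) (by linarith [Real.add_one_le_exp (z / a)])

lemma exp_neg_le_one_sub {y : ℝ} (h0 : 0 ≤ y) (h1 : y ≤ 1) : Real.exp (-y) ≤ 1 - y / 2 := by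
  rw [Real.exp_neg]
  refine inv_le_of_inv_le₀ (by linarith) ?_
  refine le_trans ?_ (Real.add_one_le_exp y)
  rw [inv_le_iff_one_le_mul₀ (by linarith)]
  nlinarith

/-- Markov's inequality for a mean of `k` samples. -/
lemma card_filter_lt_sum_mul_le [NeZero N] (hk : 1 ≤ k) (h : Fin N → ℝ) (hh : ∀ j, 0 ≤ h j)
    {θ : ℝ} :
    ((Finset.univ.filter fun ρ : Fin k → Fin N => k * θ < ∑ s, h (ρ s)).card : ℝ) * θ ≤
      Fintype.card (Fin k → Fin N) * ((1 / (N : ℝ)) * ∑ j, h j) := by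
  have hk0 : (0 : ℝ) < k := by exact_mod_cast hk
  have hN : (0 : ℝ) < N := by exact_mod_cast NeZero.pos N
  have h1 : ((Finset.univ.filter fun ρ : Fin k → Fin N => k * θ < ∑ s, h (ρ s)).card : ℝ) *
      (k * θ) ≤ ∑ ρ : Fin k → Fin N, ∑ s, h (ρ s) := by
    rw [← nsmul_eq_mul]
    refine (Finset.card_nsmul_le_sum _ (fun ρ : Fin k → Fin N => ∑ s, h (ρ s)) _
      fun ρ hρ => (Finset.mem_filter.1 hρ).2.le).trans ?_
    exact Finset.sum_le_sum_of_subset_of_nonneg (Finset.filter_subset _ _)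
      fun ρ _ _ => Finset.sum_nonneg fun s _ => hh _
  have h2 : ∀ s : Fin k, ∑ ρ : Fin k → Fin N, h (ρ s) =
      Fintype.card (Fin k → Fin N) * ((1 / (N : ℝ)) * ∑ j, h j) := fun s => by
    have := sum_apply_eq s h
    rw [Fintype.card_fin] at this
    rw [← mul_assoc, mul_one_div, div_mul_eq_mul_div, ← this]
    field_simp
  rw [Finset.sum_comm, Finset.sum_congr rfl fun s _ => h2 s] at h1
  simp only [Finset.sum_const, Finset.card_univ, Fintype.card_fin (n := k), nsmul_eq_mul] at h1
  refine le_of_mul_le_mul_left ?_ hk0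
  linarith

/-- A lower tail bound for a mean of `k` samples of a nonnegative function most of whose mean
comes from values at most `T`. -/
lemma card_filter_sum_le [NeZero N] (h : Fin N → ℝ) (hh : ∀ j, 0 ≤ h j) {θ μ T : ℝ}
    (hμ : μ = (1 / (N : ℝ)) * ∑ j, h j) (hT : 0 < T) (hθ : 8 * θ ≤ μ)
    (htail : (1 / (N : ℝ)) * ∑ j with T < h j, h j ≤ μ / 2) :
    ((Finset.univ.filter fun ρ : Fin k → Fin N => ∑ s, h (ρ s) ≤ k * θ).card : ℝ) ≤
      Fintype.card (Fin k → Fin N) * Real.exp (-(k * μ / (8 * T))) := by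
  have hN : (0 : ℝ) < N := by exact_mod_cast NeZero.pos N
  -- Use e^(-y) ≤ 1 - y/2 where `h j ≤ T`, and e^(-y) ≤ 1 elsewhere. The values at most `T` carry at
  -- least half of the mean, so the Laplace transform is at most 1 - μ/(4T).
  have hmean : ∑ j, Real.exp (-(h j / T)) ≤ N * Real.exp (-(μ / (4 * T))) := by
    have h1 : ∀ j, Real.exp (-(h j / T)) ≤ 1 - (h j - if T < h j then h j else 0) / (2 * T) := by
      intro j
      split_ifs with hj
      · simpa using div_nonneg (hh j) hT.le
      · refine (exp_neg_le_one_sub (div_nonneg (hh j) hT.le)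
          ((div_le_one hT).2 (not_lt.1 hj))).trans (le_of_eq ?_)
        field_simp
        ring
    refine (Finset.sum_le_sum fun j _ => h1 j).trans ?_
    rw [Finset.sum_sub_distrib, ← Finset.sum_div, Finset.sum_sub_distrib, ← Finset.sum_filter]
    simp only [Finset.sum_const, Finset.card_univ, Fintype.card_fin, nsmul_eq_mul, mul_one]
    have h2 : ∑ j, h j = N * μ := by rw [hμ]; field_simp
    rw [one_div, inv_mul_le_iff₀ hN] at htail
    rw [h2]
    calc (N : ℝ) - (N * μ - ∑ j with T < h j, h j) / (2 * T)
        ≤ N - (N * μ - N * (μ / 2)) / (2 * T) := by gcongr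
      _ = N * (-(μ / (4 * T)) + 1) := by field_simp; ring
      _ ≤ _ := by gcongr; exact Real.add_one_le_exp _
  -- Chernoff's method. On the event, `8 * θ ≤ μ` bounds the sum by kμ/8, so half of the exponent
  -- kμ/(4T) survives.
  have hpt : ∀ ρ ∈ Finset.univ.filter fun ρ : Fin k → Fin N => ∑ s, h (ρ s) ≤ k * θ,
      (1 : ℝ) ≤ Real.exp (k * μ / (8 * T)) * ∏ s, Real.exp (-(h (ρ s) / T)) := by
    intro ρ hρ
    rw [← Real.exp_sum, ← Real.exp_add, Real.one_le_exp_iff, Finset.sum_neg_distrib,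
      ← Finset.sum_div]
    have h1 := (Finset.mem_filter.1 hρ).2
    have h2 : ∑ s, h (ρ s) ≤ k * μ / 8 := by nlinarith [(Nat.cast_nonneg k : (0 : ℝ) ≤ k)]
    have h3 : (∑ s, h (ρ s)) / T ≤ k * μ / 8 / T := by gcongr
    rw [div_div] at h3
    linarith
  have hsum := Finset.card_nsmul_le_sum _ _ _ hpt
  rw [nsmul_eq_mul, mul_one] at hsum
  refine hsum.trans ?_
  rw [← Finset.mul_sum]
  have hprod : ∑ ρ ∈ Finset.univ.filter (fun ρ : Fin k → Fin N => ∑ s, h (ρ s) ≤ k * θ),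
      ∏ s, Real.exp (-(h (ρ s) / T)) ≤ (∑ j, Real.exp (-(h j / T))) ^ k := by
    have e : (∑ j, Real.exp (-(h j / T))) ^ k =
        ∑ ρ : Fin k → Fin N, ∏ s, Real.exp (-(h (ρ s) / T)) := by
      have := Finset.prod_univ_sum (fun _ : Fin k => (Finset.univ : Finset (Fin N)))
        fun _ j => Real.exp (-(h j / T))
      rwa [Fintype.piFinset_univ, Finset.prod_const, Finset.card_univ, Fintype.card_fin] at this
    rw [e]
    exact Finset.sum_le_sum_of_subset_of_nonneg (Finset.filter_subset _ _)
      fun ρ _ _ => Finset.prod_nonneg fun s _ => (Real.exp_pos _).le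
  calc _ ≤ Real.exp (k * μ / (8 * T)) * (N * Real.exp (-(μ / (4 * T)))) ^ k := by
        gcongr
        exact hprod.trans (pow_le_pow_left₀ (Finset.sum_nonneg fun _ _ => (Real.exp_pos _).le)
          hmean k)
    _ = _ := by
        rw [mul_pow, ← Real.exp_nat_mul, mul_left_comm, ← Real.exp_add]
        congr 1
        · simp
        · congr 1; field_simp; ring

variable {E : Type*} [SeminormedAddCommGroup E] {u v : ℝ≥0∞}

/-- Large values contribute little to the `v`-norm of a function whose `u`-norm is controlled. -/
lemma mean_filter_le [NeZero N] (hv : 1 ≤ v) (hvu : v < u) (f : Fin N → E) {T : ℝ}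
    (hw : 0 < lNorm v f)
    (hT : T = lNorm v f ^ v.toReal *
      (lNorm u f / lNorm v f) ^ (1 / ((v⁻¹).toReal - (u⁻¹).toReal)) *
        2 ^ (1 / (v.toReal * ((v⁻¹).toReal - (u⁻¹).toReal)))) :
    (1 / (N : ℝ)) * ∑ j with T < ‖f j‖ ^ v.toReal, ‖f j‖ ^ v.toReal ≤
      lNorm v f ^ v.toReal / 2 := by
  have hvt := hvu.ne_top
  have hV := one_le_toReal hv hvt
  have hu := hv.trans hvu.le
  have ev := toReal_inv_mul_toReal hv hvt
  have hwx := lNorm_anti hv hvu.le (NeZero.one_le (n := N)) f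
  have hx := hw.trans_le hwx
  have hδ := sub_pos.2 (toReal_inv_strictAnti hv hvu)
  have hTpos : 0 < T := by rw [hT]; positivity
  by_cases hut : u = ∞
  · subst hut
    -- For u = ∞ the threshold exceeds every value, and the tail is empty.
    have hT' : T = 2 * lNorm ∞ f ^ v.toReal := by
      have e : 1 / ((v⁻¹).toReal - ((∞ : ℝ≥0∞)⁻¹).toReal) = v.toReal := by
        simp [ENNReal.toReal_inv]
      rw [hT, e, ENNReal.inv_top, ENNReal.toReal_zero, sub_zero, mul_comm v.toReal, ev,
        Real.div_rpow hx.le hw.le]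
      have : lNorm v f ^ v.toReal ≠ 0 := by positivity
      field_simp
      simp
    have hempty : (Finset.univ.filter fun j => T < ‖f j‖ ^ v.toReal) = ∅ := by
      refine Finset.filter_eq_empty_iff.2 fun j _ => not_lt.2 ?_
      have h1 := Real.rpow_le_rpow (norm_nonneg _) (norm_le_lNorm_top f j) (by positivity : 0 ≤ v.toReal)
      have h2 : 0 ≤ lNorm ∞ f ^ v.toReal := by positivity
      linarith
    rw [hempty]
    simp only [Finset.sum_empty, mul_zero]
    positivity
  · have hU := one_le_toReal hu hut
    have eu := toReal_inv_mul_toReal hu hut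
    have hVU : v.toReal < u.toReal := (ENNReal.toReal_lt_toReal hvt hut).2 hvu
    set V := v.toReal
    set U := u.toReal
    set δ := (v⁻¹).toReal - (u⁻¹).toReal with hδdef
    have hδU : δ * U * V = U - V := by
      rw [hδdef]; linear_combination U * ev - V * eu
    -- Where `‖f j‖ ^ V > T` one has `T ^ (δ * U) * ‖f j‖ ^ V ≤ ‖f j‖ ^ U`, because δU = (U - V)/V.
    -- The threshold `T` is chosen so that dividing the U-th moment by `T ^ (δ * U)` leaves at most
    -- half of the V-th moment.
    have hTpow : lNorm u f ^ U ≤ (lNorm v f ^ V / 2) * T ^ (δ * U) := by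
      have h2 : (2 : ℝ) ≤ 2 ^ (1 / (V * δ) * (δ * U)) := by
        have : (1 : ℝ) ≤ 1 / (V * δ) * (δ * U) := by
          rw [show 1 / (V * δ) * (δ * U) = U / V by field_simp, one_le_div (by positivity)]
          exact hVU.le
        simpa using Real.rpow_le_rpow_of_exponent_le one_le_two this
      rw [hT, Real.mul_rpow (by positivity) (by positivity),
        Real.mul_rpow (by positivity) (by positivity), ← Real.rpow_mul hw.le,
        ← Real.rpow_mul (by positivity), ← Real.rpow_mul (by positivity),
        show V * (δ * U) = U - V by linarith, show 1 / δ * (δ * U) = U by field_simp,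
        Real.div_rpow hx.le hw.le, Real.rpow_sub hw]
      have hwV : 0 < lNorm v f ^ V := by positivity
      have hwU : 0 < lNorm v f ^ U := by positivity
      have : lNorm v f ^ V / 2 * (lNorm v f ^ U / lNorm v f ^ V *
          (lNorm u f ^ U / lNorm v f ^ U) * 2 ^ (1 / (V * δ) * (δ * U))) =
          lNorm u f ^ U * (2 ^ (1 / (V * δ) * (δ * U)) / 2) := by field_simp
      rw [this]
      exact le_mul_of_one_le_right (by positivity) (by linarith)
    have hpt : ∀ j ∈ Finset.univ.filter (fun j => T < ‖f j‖ ^ V),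
        T ^ (δ * U) * ‖f j‖ ^ V ≤ ‖f j‖ ^ U := by
      intro j hj
      have hj := (Finset.mem_filter.1 hj).2
      calc T ^ (δ * U) * ‖f j‖ ^ V ≤ (‖f j‖ ^ V) ^ (δ * U) * ‖f j‖ ^ V := by gcongr
        _ = ‖f j‖ ^ U := by
          rw [← Real.rpow_mul (norm_nonneg _), ← Real.rpow_add_of_nonneg (norm_nonneg _)
            (by positivity) (by positivity)]
          congr 1
          linarith
    have hTp : 0 < T ^ (δ * U) := by positivity
    refine le_of_mul_le_mul_left ?_ hTp
    calc T ^ (δ * U) * ((1 / (N : ℝ)) * ∑ j with T < ‖f j‖ ^ V, ‖f j‖ ^ V)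
        = (1 / (N : ℝ)) * ∑ j with T < ‖f j‖ ^ V, T ^ (δ * U) * ‖f j‖ ^ V := by
          rw [← Finset.mul_sum]; ring
      _ ≤ (1 / (N : ℝ)) * ∑ j, ‖f j‖ ^ U := by
          gcongr
          refine (Finset.sum_le_sum hpt).trans ?_
          exact Finset.sum_le_sum_of_subset_of_nonneg (Finset.filter_subset _ _)
            fun _ _ _ => by positivity
      _ = lNorm u f ^ U := (lNorm_rpow hu hut f).symm
      _ ≤ _ := by linarith

/-- The constant in `card_filter_sum_norm_le`. -/
noncomputable def tailConst (V δ a : ℝ) : ℝ := (a * δ / (2 ^ (-(1 / (V * δ))) / 8)) ^ (a * δ)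

lemma tailConst_pos {V δ a : ℝ} (hδ : 0 < δ) (ha : 0 < a) : 0 < tailConst V δ a := by
  unfold tailConst; positivity

/-- For the threshold of `mean_filter_le`, the Chernoff exponent is a constant times
(k^δ‖f‖_v/‖f‖_u)^(1/δ). `exp_neg_le_rpow` with exponent aδ turns it into (k^(-δ)‖f‖_u/‖f‖_v)^a, and
the factor ‖f‖_v^a cancels the denominator. -/
lemma card_filter_sum_norm_le [NeZero N] (hv : 1 ≤ v) (hvu : v < u) (hk : 1 ≤ k) (f : Fin N → E)
    {θ a : ℝ} (hθ : 0 < θ) (ha : 0 < a) (hθw : 8 * θ ≤ lNorm v f ^ v.toReal) :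
    lNorm v f ^ a *
      ((Finset.univ.filter fun ρ : Fin k → Fin N => ∑ s, ‖f (ρ s)‖ ^ v.toReal ≤ k * θ).card : ℝ) ≤
      Fintype.card (Fin k → Fin N) *
        (tailConst v.toReal ((v⁻¹).toReal - (u⁻¹).toReal) a *
          ((k : ℝ) ^ (-((v⁻¹).toReal - (u⁻¹).toReal)) * lNorm u f) ^ a) := by
  have hvt := hvu.ne_top
  have hV := one_le_toReal hv hvt
  have hk0 : (0 : ℝ) < k := by exact_mod_cast hk
  have hδ := sub_pos.2 (toReal_inv_strictAnti hv hvu)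
  have hw : 0 < lNorm v f := by
    refine (lNorm_nonneg _ _).lt_of_ne' fun h0 => ?_
    rw [h0, Real.zero_rpow (by positivity)] at hθw
    linarith
  have hx := hw.trans_le (lNorm_anti hv hvu.le (NeZero.one_le (n := N)) f)
  set V := v.toReal
  set δ := (v⁻¹).toReal - (u⁻¹).toReal with hδdef
  set wn := lNorm v f with hwn
  set xn := lNorm u f with hxn
  set T := wn ^ V * (xn / wn) ^ (1 / δ) * 2 ^ (1 / (V * δ)) with hT
  have hTpos : 0 < T := by positivity
  have h1 := card_filter_sum_le (k := k) (fun j => ‖f j‖ ^ V) (fun j => by positivity)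
    (lNorm_rpow hv hvt f) hTpos hθw (mean_filter_le hv hvu f hw hT)
  set c : ℝ := 2 ^ (-(1 / (V * δ))) / 8 with hc
  have hcpos : 0 < c := by positivity
  have hz : (k : ℝ) * wn ^ V / (8 * T) = c * ((k : ℝ) ^ δ * wn / xn) ^ (1 / δ) := by
    rw [hc, hT, Real.rpow_neg (by norm_num), mul_div_assoc ((k : ℝ) ^ δ),
      Real.mul_rpow (by positivity) (by positivity), ← Real.rpow_mul hk0.le,
      mul_one_div_cancel hδ.ne', Real.rpow_one, ← inv_div xn wn, Real.inv_rpow (by positivity)]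
    field_simp
  have hzpos : 0 < c * ((k : ℝ) ^ δ * wn / xn) ^ (1 / δ) := by positivity
  have h2 := exp_neg_le_rpow hzpos (show 0 < a * δ by positivity)
  have h3 : (a * δ / (c * ((k : ℝ) ^ δ * wn / xn) ^ (1 / δ))) ^ (a * δ) =
      tailConst V δ a * ((k : ℝ) ^ (-δ) * xn / wn) ^ a := by
    rw [← div_div, Real.div_rpow (by positivity) (by positivity), ← Real.rpow_mul (by positivity),
      show 1 / δ * (a * δ) = a by field_simp, tailConst, div_eq_mul_inv,
      ← Real.inv_rpow (by positivity)]
    congr 2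
    rw [Real.rpow_neg hk0.le]
    field_simp
  rw [hz] at h1
  rw [h3] at h2
  calc _ ≤ wn ^ a * (Fintype.card (Fin k → Fin N) *
        (tailConst V δ a * ((k : ℝ) ^ (-δ) * xn / wn) ^ a)) := by
        gcongr
        exact h1.trans (by gcongr)
    _ = _ := by
        rw [Real.div_rpow (by positivity) hw.le]
        field_simp

end Sampling

/-! ### Cost and error of the two-stage method -/

section UpperBound

variable {𝕜 : Type*} [RCLike 𝕜] {p q u v : ℝ≥0∞} {N₁ N₂ R k : ℕ}

/-- The samples of `ω` detect `g`: in each of the `R` groups, the mean of `‖g‖ ^ V` is more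
than `θ`. -/
def Detects (V θ : ℝ) (g : Fin N₂ → 𝕜) (ω : Fin R → Fin k → Fin N₂) : Prop :=
  ∀ r, k * θ < ∑ s, ‖g (ω r s)‖ ^ V

open Classical in
/-- The points in the columns sampled by `ω`. -/
noncomputable def samplePoints (N₁ : ℕ) (ω : Fin R → Fin k → Fin N₂) : List (Fin N₁ × Fin N₂) :=
  (Finset.univ ×ˢ (Finset.univ : Finset (Fin R × Fin k)).image fun z => ω z.1 z.2).toList

open Classical in
/-- The points of the rows detected by `ω`. -/
noncomputable def detectedPoints (V θ : ℝ) (ω : Fin R → Fin k → Fin N₂)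
    (f : Fin N₁ → Fin N₂ → 𝕜) : List (Fin N₁ × Fin N₂) :=
  ((Finset.univ.filter fun i => Detects V θ (f i) ω) ×ˢ Finset.univ).toList

lemma detectedPoints_congr (V θ : ℝ) (ω : Fin R → Fin k → Fin N₂) (f g : Fin N₁ → Fin N₂ → 𝕜)
    (h : ∀ s t, (s, t) ∈ samplePoints N₁ ω → f s t = g s t) :
    detectedPoints V θ ω f = detectedPoints V θ ω g := by
  classical
  have : ∀ i, Detects V θ (f i) ω ↔ Detects V θ (g i) ω := by
    intro i
    have e : ∀ r s, f i (ω r s) = g i (ω r s) := fun r s => h _ _ (by simp [samplePoints])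
    simp only [Detects, e]
  rw [detectedPoints, detectedPoints, Finset.filter_congr fun i _ => this i]

open Classical in
lemma length_points_le (V θ : ℝ) (ω : Fin R → Fin k → Fin N₂) (f : Fin N₁ → Fin N₂ → 𝕜) :
    (samplePoints N₁ ω ++ detectedPoints V θ ω f).length ≤
      N₁ * (R * k) + ∑ i, if Detects V θ (f i) ω then N₂ else 0 := by
  rw [List.length_append, samplePoints, detectedPoints, Finset.length_toList, Finset.length_toList,
    Finset.card_product, Finset.card_product, ← Finset.sum_filter]
  simp only [Finset.card_univ, Fintype.card_fin, Finset.sum_const, smul_eq_mul]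
  gcongr
  exact Finset.card_image_le.trans (by simp)

open Classical in
-- The groups are independent, so Markov's inequality gives y^R with y = ‖g‖_v^V/θ. If y ≤ 1, the
-- exponent may be lowered to P/V; if y ≥ 1, the bound is trivial. The power `P` is what the p-norm
-- over the rows can absorb.
lemma card_filter_detects_le [NeZero N₂] (hk : 1 ≤ k) (hv : 1 ≤ v) (hvt : v ≠ ∞)
    (g : Fin N₂ → 𝕜) {θ P : ℝ} (hθ : 0 < θ) (hP : 0 < P) (hPR : P ≤ R * v.toReal) :
    ((Finset.univ.filter fun ω : Fin R → Fin k → Fin N₂ => Detects v.toReal θ g ω).card : ℝ) ≤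
      Fintype.card (Fin R → Fin k → Fin N₂) * (lNorm v g ^ P / θ ^ (P / v.toReal)) := by
  have hV := one_le_toReal hv hvt
  have hw := lNorm_nonneg v g
  set s := Finset.univ.filter fun ρ : Fin k → Fin N₂ => k * θ < ∑ s, ‖g (ρ s)‖ ^ v.toReal with hs
  have hpi : (Finset.univ.filter fun ω : Fin R → Fin k → Fin N₂ => Detects v.toReal θ g ω) =
      Fintype.piFinset fun _ => s := by
    ext ω
    rw [Finset.mem_filter, Fintype.mem_piFinset]
    simp [Detects, hs]
  set Γ : ℝ := (Fintype.card (Fin k → Fin N₂) : ℝ) with hΓ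
  have hΓpos : 0 < Γ := by rw [hΓ]; exact_mod_cast Fintype.card_pos
  have hcard : (Fintype.card (Fin R → Fin k → Fin N₂) : ℝ) = Γ ^ R := by
    rw [hΓ, Fintype.card_fun (α := Fin R)]; simp
  have hm := card_filter_lt_sum_mul_le hk (fun j => ‖g j‖ ^ v.toReal) (fun j => by positivity)
    (θ := θ)
  rw [← lNorm_rpow hv hvt, ← le_div_iff₀ hθ, ← hs, ← hΓ, mul_div_assoc] at hm
  rw [hpi, Fintype.card_piFinset_const, hcard]
  push_cast
  set y := lNorm v g ^ v.toReal / θ with hy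
  have hy0 : 0 ≤ y := by positivity
  have hyP : lNorm v g ^ P / θ ^ (P / v.toReal) = y ^ (P / v.toReal) := by
    rw [hy, Real.div_rpow (by positivity) hθ.le, ← Real.rpow_mul hw, mul_div_cancel₀ _ (by positivity)]
  rw [hyP]
  have hle : (s.card : ℝ) ≤ Γ := by
    rw [hΓ]; exact_mod_cast Finset.card_le_univ s
  rcases le_total y 1 with h1 | h1
  · calc (s.card : ℝ) ^ R ≤ (Γ * y) ^ R := by gcongr
      _ = Γ ^ R * y ^ (R : ℝ) := by rw [mul_pow, Real.rpow_natCast]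
      _ ≤ _ := by
        exact mul_le_mul_of_nonneg_left (Real.rpow_le_rpow_of_exponent_ge' hy0 h1 (by positivity)
          ((div_le_iff₀ (by positivity)).2 hPR)) (by positivity)
  · calc (s.card : ℝ) ^ R ≤ Γ ^ R := by gcongr
      _ ≤ _ := le_mul_of_one_le_right (by positivity)
        (Real.one_le_rpow h1 (by positivity))

open Classical in
-- A union bound over the `R` groups; `R` does not grow with n, N₁, N₂, so it only affects the
-- constant.
lemma card_filter_not_detects_le [NeZero N₂] (hk : 1 ≤ k) (hv : 1 ≤ v) (hvu : v < u)
    (g : Fin N₂ → 𝕜) {θ a : ℝ} (hθ : 0 < θ) (ha : 0 < a)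
    (hθw : 8 * θ ≤ lNorm v g ^ v.toReal) :
    lNorm v g ^ a * ((Finset.univ.filter fun ω : Fin R → Fin k → Fin N₂ =>
        ¬ Detects v.toReal θ g ω).card : ℝ) ≤
      Fintype.card (Fin R → Fin k → Fin N₂) *
        (R * tailConst v.toReal ((v⁻¹).toReal - (u⁻¹).toReal) a *
          ((k : ℝ) ^ (-((v⁻¹).toReal - (u⁻¹).toReal)) * lNorm u g) ^ a) := by
  have hw := lNorm_nonneg v g
  set s := Finset.univ.filter fun ρ : Fin k → Fin N₂ => ∑ s, ‖g (ρ s)‖ ^ v.toReal ≤ k * θ with hs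
  set Γ : ℝ := (Fintype.card (Fin k → Fin N₂) : ℝ) with hΓ
  have hΓpos : 0 < Γ := by rw [hΓ]; exact_mod_cast Fintype.card_pos
  have htail := card_filter_sum_norm_le hv hvu hk g hθ ha hθw
  rw [← hs, ← hΓ] at htail
  have hunion : ((Finset.univ.filter fun ω : Fin R → Fin k → Fin N₂ =>
      ¬ Detects v.toReal θ g ω).card : ℝ) ≤
      ∑ r : Fin R, ∑ ω : Fin R → Fin k → Fin N₂, if ω r ∈ s then (1 : ℝ) else 0 := by
    rw [Finset.sum_comm, Finset.card_filter, Nat.cast_sum]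
    refine Finset.sum_le_sum fun ω _ => ?_
    by_cases h : Detects v.toReal θ g ω
    · simp only [h, not_true, if_false, Nat.cast_zero]
      exact Finset.sum_nonneg fun r _ => by split_ifs <;> norm_num
    · obtain ⟨r, hr⟩ := not_forall.1 h
      have := Finset.single_le_sum (f := fun r : Fin R => if ω r ∈ s then (1 : ℝ) else 0)
        (fun _ _ => by split_ifs <;> norm_num) (Finset.mem_univ r)
      have hrs : ω r ∈ s := by simpa [hs] using hr
      simp only [hrs, if_true] at this
      simpa only [h, not_false_eq_true, if_true, Nat.cast_one] using this
  have hone : ∀ r : Fin R, Γ * ∑ ω : Fin R → Fin k → Fin N₂, (if ω r ∈ s then (1 : ℝ) else 0) =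
      Fintype.card (Fin R → Fin k → Fin N₂) * s.card := fun r => by
    have := sum_apply_eq (B := Fin R) r fun ρ : Fin k → Fin N₂ => if ρ ∈ s then (1 : ℝ) else 0
    rw [← hΓ] at this
    rw [this]
    simp
  have h1 : Γ * ((Finset.univ.filter fun ω : Fin R → Fin k → Fin N₂ =>
      ¬ Detects v.toReal θ g ω).card : ℝ) ≤
      R * (Fintype.card (Fin R → Fin k → Fin N₂) * s.card) := by
    refine (mul_le_mul_of_nonneg_left hunion hΓpos.le).trans (le_of_eq ?_)
    rw [Finset.mul_sum, Finset.sum_congr rfl fun r _ => hone r]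
    simp
  refine le_of_mul_le_mul_left ?_ hΓpos
  calc _ = lNorm v g ^ a * (Γ * ((Finset.univ.filter fun ω : Fin R → Fin k → Fin N₂ =>
        ¬ Detects v.toReal θ g ω).card : ℝ)) := by ring
    _ ≤ lNorm v g ^ a * (R * (Fintype.card (Fin R → Fin k → Fin N₂) * s.card)) := by gcongr
    _ = R * Fintype.card (Fin R → Fin k → Fin N₂) * (lNorm v g ^ a * s.card) := by ring
    _ ≤ _ := mul_le_mul_of_nonneg_left htail (by positivity)
    _ = _ := by ring

lemma sum_lNorm_rpow_le (hp : 1 ≤ p) (hpt : p ≠ ∞) (hN₁ : 1 ≤ N₁) (f : MixedBall 𝕜 p u N₁ N₂) :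
    ∑ i, lNorm u (f.1 i) ^ p.toReal ≤ N₁ := by
  have hN : (0 : ℝ) < N₁ := by exact_mod_cast hN₁
  have := (lNorm_le_iff hp hpt _ zero_le_one).1 f.2
  simp only [Real.norm_of_nonneg (lNorm_nonneg _ _), Real.one_rpow] at this
  rwa [one_div, inv_mul_le_iff₀ hN, mul_one] at this

open Classical in
-- The sampling cost is deterministic; the number of rows read completely is bounded only on
-- average, which the definition of cardinality permits.
lemma sum_length_points_le [NeZero N₂] (hp : 1 ≤ p) (hpt : p ≠ ∞) (hN₁ : 1 ≤ N₁) (hk : 1 ≤ k)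
    (hv : 1 ≤ v) (hvu : v < u) {θ : ℝ} (hθ : 0 < θ) (hPR : p.toReal ≤ R * v.toReal)
    (f : MixedBall 𝕜 p u N₁ N₂) :
    ∑ ω : Fin R → Fin k → Fin N₂,
        ((samplePoints N₁ ω ++ detectedPoints v.toReal θ ω f.1).length : ℝ) ≤
      (N₁ * (R * k) + N₂ * (N₁ / θ ^ (p.toReal / v.toReal))) *
        Fintype.card (Fin R → Fin k → Fin N₂) := by
  have hP := one_le_toReal hp hpt
  have h1 : ∀ ω : Fin R → Fin k → Fin N₂,
      ((samplePoints N₁ ω ++ detectedPoints v.toReal θ ω f.1).length : ℝ) ≤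
      N₁ * (R * k) + ∑ i, if Detects v.toReal θ (f.1 i) ω then (N₂ : ℝ) else 0 := fun ω => by
    exact_mod_cast length_points_le v.toReal θ ω f.1
  have h2 : ∀ i, ∑ ω : Fin R → Fin k → Fin N₂,
      (if Detects v.toReal θ (f.1 i) ω then (N₂ : ℝ) else 0) ≤
      N₂ * (Fintype.card (Fin R → Fin k → Fin N₂) *
        (lNorm u (f.1 i) ^ p.toReal / θ ^ (p.toReal / v.toReal))) := by
    intro i
    rw [← Finset.sum_filter, Finset.sum_const, nsmul_eq_mul, mul_comm]
    gcongr
    refine (card_filter_detects_le hk hv hvu.ne_top (f.1 i) hθ (by positivity) hPR).trans ?_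
    gcongr
    · exact lNorm_nonneg _ _
    · exact lNorm_anti hv hvu.le NeZero.one_le _
  refine (Finset.sum_le_sum fun ω _ => h1 ω).trans ?_
  rw [Finset.sum_add_distrib, Finset.sum_comm]
  refine (add_le_add le_rfl (Finset.sum_le_sum fun i _ => h2 i)).trans ?_
  rw [Finset.sum_const, nsmul_eq_mul, Finset.card_univ, ← Finset.mul_sum, ← Finset.mul_sum,
    ← Finset.sum_div, add_mul, mul_assoc (N₂ : ℝ), mul_comm (_ / _ : ℝ),
    mul_comm (Fintype.card (Fin R → Fin k → Fin N₂) : ℝ) (_ * _)]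
  gcongr
  exact sum_lNorm_rpow_le hp hpt hN₁ f

open Classical in
/-- The mean error caused by the undetected rows of large norm. -/
lemma sum_lNorm_undetected_le [NeZero N₂] (hp : 1 ≤ p) (hpq : p < q) (hN₁ : 1 ≤ N₁) (hk : 1 ≤ k)
    (hv : 1 ≤ v) (hvu : v < u) {θ : ℝ} (hθ : 0 < θ) (f : MixedBall 𝕜 p u N₁ N₂) :
    ∑ ω : Fin R → Fin k → Fin N₂, lNorm q (fun i =>
        if ¬ Detects v.toReal θ (f.1 i) ω ∧ 8 * θ ≤ lNorm v (f.1 i) ^ v.toReal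
          then lNorm v (f.1 i) else 0) ≤
      ((N₁ : ℝ) ^ ((p⁻¹).toReal - (q⁻¹).toReal) *
        ((R * tailConst v.toReal ((v⁻¹).toReal - (u⁻¹).toReal) p.toReal) ^ (1 / p.toReal) *
          (k : ℝ) ^ (-((v⁻¹).toReal - (u⁻¹).toReal)))) *
        Fintype.card (Fin R → Fin k → Fin N₂) := by
  have hpt := hpq.ne_top
  have hP := one_le_toReal hp hpt
  have hN : (0 : ℝ) < N₁ := by exact_mod_cast hN₁
  have hδ := sub_pos.2 (toReal_inv_strictAnti hv hvu)
  set δ := (v⁻¹).toReal - (u⁻¹).toReal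
  set P := p.toReal
  set C := tailConst v.toReal δ P with hCdef
  have hC : 0 < C := tailConst_pos hδ (by positivity)
  set W := Fintype.card (Fin R → Fin k → Fin N₂) with hW
  have hWpos : (0 : ℝ) < W := by rw [hW]; exact_mod_cast Fintype.card_pos
  set g : (Fin R → Fin k → Fin N₂) → Fin N₁ → ℝ := fun ω i =>
    if ¬ Detects v.toReal θ (f.1 i) ω ∧ 8 * θ ≤ lNorm v (f.1 i) ^ v.toReal
      then lNorm v (f.1 i) else 0 with hg
  -- Row by row, the mean P-th power of the missed norm is at most a constant times
  -- (k^(-δ)‖f_i‖_u)^P, and the sum over the rows uses only that `f` is in the unit ball.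
  have hpow : ∑ ω, lNorm p (g ω) ^ P ≤ W * (R * C * ((k : ℝ) ^ (-δ)) ^ P) := by
    simp only [P, lNorm_rpow hp hpt]
    rw [← Finset.mul_sum, Finset.sum_comm]
    have hrow : ∀ i, ∑ ω, ‖g ω i‖ ^ P ≤
        W * (R * C * ((k : ℝ) ^ (-δ)) ^ P) * lNorm u (f.1 i) ^ P := by
      intro i
      have hx := lNorm_nonneg u (f.1 i)
      by_cases hi : 8 * θ ≤ lNorm v (f.1 i) ^ v.toReal
      · have h1 : ∑ ω, ‖g ω i‖ ^ P = lNorm v (f.1 i) ^ P *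
            (Finset.univ.filter fun ω : Fin R → Fin k → Fin N₂ =>
              ¬ Detects v.toReal θ (f.1 i) ω).card := by
          have : ∀ ω, ‖g ω i‖ ^ P =
              if ¬ Detects v.toReal θ (f.1 i) ω then lNorm v (f.1 i) ^ P else 0 := by
            intro ω
            simp only [hg, hi, and_true]
            split_ifs
            · rw [norm_zero, Real.zero_rpow (by positivity)]
            · rw [Real.norm_of_nonneg (lNorm_nonneg _ _)]
          rw [Finset.sum_congr rfl fun ω _ => this ω, ← Finset.sum_filter, Finset.sum_const,
            nsmul_eq_mul, mul_comm]
        rw [h1]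
        refine (card_filter_not_detects_le hk hv hvu (f.1 i) hθ (by positivity) hi).trans
          (le_of_eq ?_)
        rw [Real.mul_rpow (by positivity) hx]
        ring
      · have h1 : ∀ ω, ‖g ω i‖ ^ P = 0 := by
          intro ω
          simp only [hg, hi, and_false, if_false, norm_zero]
          exact Real.zero_rpow (by positivity)
        simp only [h1, Finset.sum_const_zero]
        positivity
    have h2 := Finset.sum_le_sum fun i (_ : i ∈ Finset.univ) => hrow i
    rw [← Finset.mul_sum] at h2
    have h3 := h2.trans (mul_le_mul_of_nonneg_left (sum_lNorm_rpow_le hp hpt hN₁ f)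
      (show 0 ≤ W * (R * C * ((k : ℝ) ^ (-δ)) ^ P) by positivity))
    rw [one_div, inv_mul_le_iff₀ hN]
    linarith
  -- Jensen's inequality passes from the P-th moment over `ω` to the first moment; the embedding of
  -- L_p into L_q then costs N₁^(1/p-1/q).
  have hmean := mean_rpow_le (Finset.univ : Finset (Fin R → Fin k → Fin N₂))
    (fun ω => lNorm p (g ω)) (fun _ _ => lNorm_nonneg _ _) hP Finset.univ_nonempty
  rw [Finset.card_univ, ← hW] at hmean
  have h4 : ((1 / (W : ℝ)) * ∑ ω, lNorm p (g ω)) ^ P ≤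
      ((R * C) ^ (1 / P) * (k : ℝ) ^ (-δ)) ^ P := by
    refine hmean.trans ?_
    rw [Real.mul_rpow (by positivity) (by positivity), ← Real.rpow_mul (by positivity),
      one_div_mul_cancel (by positivity), Real.rpow_one, one_div, inv_mul_le_iff₀ hWpos]
    exact hpow
  have h5 := (Real.rpow_le_rpow_iff (mul_nonneg (by positivity)
    (Finset.sum_nonneg fun _ _ => lNorm_nonneg _ _)) (by positivity) (by positivity)).1 h4
  rw [one_div, inv_mul_le_iff₀ hWpos] at h5
  calc ∑ ω, lNorm q (g ω) ≤
        ∑ ω, (N₁ : ℝ) ^ ((p⁻¹).toReal - (q⁻¹).toReal) * lNorm p (g ω) :=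
        Finset.sum_le_sum fun ω _ => lNorm_le_of_lt hp hpq _
    _ = (N₁ : ℝ) ^ ((p⁻¹).toReal - (q⁻¹).toReal) * ∑ ω, lNorm p (g ω) := by
        rw [Finset.mul_sum]
    _ ≤ (N₁ : ℝ) ^ ((p⁻¹).toReal - (q⁻¹).toReal) *
        (W * ((R * C) ^ (1 / P) * (k : ℝ) ^ (-δ))) := by gcongr
    _ = _ := by ring

open Classical in
/-- The error caused by the rows of small norm. -/
lemma lNorm_small_le [NeZero N₂] (hp : 1 ≤ p) (hpq : p < q)
    (hv : 1 ≤ v) (hvu : v < u) {θ : ℝ} (hθ : 0 < θ) (f : MixedBall 𝕜 p u N₁ N₂) :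
    lNorm q (fun i => if lNorm v (f.1 i) ^ v.toReal < 8 * θ then lNorm v (f.1 i) else 0) ≤
      (8 * θ) ^ (p.toReal / v.toReal * ((p⁻¹).toReal - (q⁻¹).toReal)) := by
  have hpt := hpq.ne_top
  have hP := one_le_toReal hp hpt
  have hV := one_le_toReal hv hvu.ne_top
  have ep := toReal_inv_mul_toReal hp hpt
  set g : Fin N₁ → ℝ := fun i =>
    if lNorm v (f.1 i) ^ v.toReal < 8 * θ then lNorm v (f.1 i) else 0 with hg
  have ht : ∀ i, ‖g i‖ ≤ (8 * θ) ^ (1 / v.toReal) := by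
    intro i
    simp only [hg]
    split_ifs with h
    · rw [Real.norm_of_nonneg (lNorm_nonneg _ _),
        ← Real.rpow_le_rpow_iff (lNorm_nonneg _ _) (by positivity) (show 0 < v.toReal by positivity),
        ← Real.rpow_mul (by positivity), one_div_mul_cancel (by positivity), Real.rpow_one]
      exact h.le
    · rw [norm_zero]; positivity
  have h1 : lNorm p g ≤ 1 := by
    refine le_trans (lNorm_mono hp fun i => ?_) f.2
    rw [Real.norm_of_nonneg (lNorm_nonneg u _)]
    simp only [hg]
    split_ifs
    · rw [Real.norm_of_nonneg (lNorm_nonneg _ _)]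
      exact lNorm_anti hv hvu.le NeZero.one_le _
    · rw [norm_zero]; exact lNorm_nonneg _ _
  -- The small rows are bounded in sup-norm by (8θ)^(1/V) and in p-norm by 1.
  refine (lNorm_le_interpolate hp hpq g (by positivity) ht).trans ?_
  rw [← Real.rpow_mul (by positivity)]
  have e : 1 / v.toReal * (1 - p.toReal * (q⁻¹).toReal) =
      p.toReal / v.toReal * ((p⁻¹).toReal - (q⁻¹).toReal) := by
    linear_combination (-1 / v.toReal) * ep
  rw [e]
  exact mul_le_of_le_one_right (by positivity)
    (Real.rpow_le_one (lNorm_nonneg _ _) h1 (by positivity))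

open Classical in
-- Detected rows are recovered exactly. On any other row the error is the input or zero at each
-- point, so its norm is at most that of the row, which is either small or missed.
lemma mixedNorm_sub_twoStage_le (hq : 1 ≤ q) (hv : 1 ≤ v) {θ : ℝ} (x₀ : Fin N₁ × Fin N₂)
    (ω : Fin R → Fin k → Fin N₂) (f : MixedBall 𝕜 p u N₁ N₂) :
    mixedNorm q v (f.1 - (twoStage (q := q) (v := v) x₀ (samplePoints N₁ ω)
        (detectedPoints v.toReal θ ω)).output f) ≤
      lNorm q (fun i => if lNorm v (f.1 i) ^ v.toReal < 8 * θ then lNorm v (f.1 i) else 0) +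
      lNorm q (fun i =>
        if ¬ Detects v.toReal θ (f.1 i) ω ∧ 8 * θ ≤ lNorm v (f.1 i) ^ v.toReal
          then lNorm v (f.1 i) else 0) := by
  refine lNorm_le_add hq fun i => ?_
  rw [Real.norm_of_nonneg (lNorm_nonneg _ _)]
  have hout := twoStage_output (q := q) (v := v) (x₀ := x₀)
    (detectedPoints_congr v.toReal θ ω) f i
  have hw := lNorm_nonneg v (f.1 i)
  have hle : lNorm v ((f.1 - (twoStage (q := q) (v := v) x₀ (samplePoints N₁ ω)
        (detectedPoints v.toReal θ ω)).output f) i) ≤ lNorm v (f.1 i) := by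
    refine lNorm_mono hv fun j => ?_
    rw [Pi.sub_apply, Pi.sub_apply, hout j]
    split_ifs <;> simp
  by_cases hd : Detects v.toReal θ (f.1 i) ω
  · have hzero : (f.1 - (twoStage (q := q) (v := v) x₀ (samplePoints N₁ ω)
        (detectedPoints v.toReal θ ω)).output f) i = 0 := by
      funext j
      rw [Pi.sub_apply, Pi.sub_apply, hout j, if_pos, sub_self, Pi.zero_apply]
      simp [detectedPoints, hd]
    rw [hzero]
    have h0 : lNorm v (0 : Fin N₂ → 𝕜) = 0 := by
      refine le_antisymm ?_ (lNorm_nonneg _ _)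
      have := lNorm_le_of_support hv (0 : Fin N₂ → 𝕜) ∅ le_rfl (by simp) (by simp)
      simpa using this
    rw [h0]
    refine add_nonneg ?_ ?_ <;> split_ifs <;> first | exact hw | exact le_rfl
  · refine hle.trans ?_
    by_cases h : lNorm v (f.1 i) ^ v.toReal < 8 * θ
    · simp [h, not_le.2 h]
    · simp [h, not_lt.1 h, hd]

variable [MeasurableSpace 𝕜] [BorelSpace 𝕜]

/-- The error of the two-stage algorithm. -/
lemma eRan_le_twoStage (hp : 1 ≤ p) (hpq : p < q) (hN₁ : 1 ≤ N₁) (hN₂ : 1 ≤ N₂) (hk : 1 ≤ k)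
    (hv : 1 ≤ v) (hvu : v < u) {θ : ℝ} (hθ : 0 < θ) (hPR : p.toReal ≤ R * v.toReal) {n : ℕ}
    (hn : N₁ * (R * k) + N₂ * (N₁ / θ ^ (p.toReal / v.toReal)) ≤ n) :
    eRan.{w} (approxProblem 𝕜 p u q v N₁ N₂) n ≤ ENNReal.ofReal
      ((8 * θ) ^ (p.toReal / v.toReal * ((p⁻¹).toReal - (q⁻¹).toReal)) +
        (N₁ : ℝ) ^ ((p⁻¹).toReal - (q⁻¹).toReal) *
        ((R * tailConst v.toReal ((v⁻¹).toReal - (u⁻¹).toReal) p.toReal) ^ (1 / p.toReal) *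
          (k : ℝ) ^ (-((v⁻¹).toReal - (u⁻¹).toReal)))) := by
  have : NeZero N₂ := ⟨by omega⟩
  have hpt := hpq.ne_top
  let x₀ : Fin N₁ × Fin N₂ := (⟨0, by omega⟩, ⟨0, by omega⟩)
  refine eRan_le_of_uniform (fun ω : Fin R → Fin k → Fin N₂ =>
    twoStage x₀ (samplePoints N₁ ω) (detectedPoints v.toReal θ ω))
    (fun ω f => (samplePoints N₁ ω ++ detectedPoints v.toReal θ ω f.1).length)
    (fun ω f => twoStage_card (detectedPoints_congr v.toReal θ ω) f) (fun f => ?_) fun f => ?_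
  · have h := (sum_length_points_le hp hpt hN₁ hk hv hvu hθ hPR f).trans
      (mul_le_mul_of_nonneg_right hn (Nat.cast_nonneg _))
    exact_mod_cast h
  · refine (Finset.sum_le_sum fun ω _ =>
      mixedNorm_sub_twoStage_le (hp.trans hpq.le) hv (θ := θ) x₀ ω f).trans ?_
    rw [Finset.sum_add_distrib, add_mul]
    refine add_le_add ?_ (sum_lNorm_undetected_le hp hpq hN₁ hk hv hvu hθ f)
    rw [Finset.sum_const, nsmul_eq_mul, Finset.card_univ, mul_comm]
    gcongr
    exact lNorm_small_le hp hpq hv hvu hθ f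

end UpperBound

/-! ### Choice of parameters and matching rates -/

section Rates

variable {𝕜 : Type*} [RCLike 𝕜] [MeasurableSpace 𝕜] [BorelSpace 𝕜] {p q u v : ℝ≥0∞}

lemma one_le_ceil_div {n : ℕ} {x : ℝ} (hn : 1 ≤ n) (hx : 0 < x) : (1 : ℝ) ≤ ⌈(n : ℝ) / x⌉₊ := by
  have hn' : (0 : ℝ) < n := by exact_mod_cast hn
  exact_mod_cast Nat.one_le_ceil_iff.2 (div_pos hn' hx)

lemma ceil_le_two_mul {x : ℝ} (hx : 1 ≤ x) : (⌈x⌉₊ : ℝ) ≤ 2 * x := by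
  have := Nat.ceil_lt_add_one (zero_le_one.trans hx)
  linarith

/-- If `a ≤ b * y` then `y ^ (-s) ≤ b ^ s * a ^ (-s)`. -/
lemma rpow_neg_le_of_le_mul {a b y s : ℝ} (ha : 0 < a) (hb : 0 < b) (hy : 0 < y) (hs : 0 ≤ s)
    (h : a ≤ b * y) : y ^ (-s) ≤ b ^ s * a ^ (-s) := by
  have h1 : (b * y) ^ (-s) ≤ a ^ (-s) :=
    Real.rpow_le_rpow_of_nonpos ha h (neg_nonpos.2 hs)
  calc y ^ (-s) = b ^ s * (b * y) ^ (-s) := by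
        rw [Real.mul_rpow hb.le hy.le, ← mul_assoc, ← Real.rpow_add hb]; simp
    _ ≤ _ := by gcongr

/-- The two-stage algorithm with `R` groups of `n / (2 * R * N₁)` samples. -/
lemma eRan_le_of_large (hp : 1 ≤ p) (hpq : p < q) (hv : 1 ≤ v) (hvu : v < u) {R n N₁ N₂ : ℕ}
    (hR1 : 1 ≤ R) (hPR : p.toReal ≤ R * v.toReal) (hN₁ : 1 ≤ N₁) (hN₂ : 1 ≤ N₂)
    (hnN₁ : 2 * R * N₁ ≤ n) (hnN₂ : N₂ ≤ n) :
    eRan.{w} (approxProblem 𝕜 p u q v N₁ N₂) n ≤ ENNReal.ofReal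
      (((8 : ℝ) ^ (p.toReal / v.toReal * ((p⁻¹).toReal - (q⁻¹).toReal)) *
          2 ^ ((p⁻¹).toReal - (q⁻¹).toReal) * 2 ^ ((p⁻¹).toReal - (q⁻¹).toReal)) *
          ((N₁ : ℝ) ^ ((p⁻¹).toReal - (q⁻¹).toReal) *
            (⌈(n : ℝ) / N₂⌉₊ : ℝ) ^ (-((p⁻¹).toReal - (q⁻¹).toReal))) +
        (N₁ : ℝ) ^ ((p⁻¹).toReal - (q⁻¹).toReal) *
          ((R * tailConst v.toReal ((v⁻¹).toReal - (u⁻¹).toReal) p.toReal) ^ (1 / p.toReal) *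
            ((8 * (R : ℝ)) ^ ((v⁻¹).toReal - (u⁻¹).toReal) *
              (⌈(n : ℝ) / N₁⌉₊ : ℝ) ^ (-((v⁻¹).toReal - (u⁻¹).toReal))))) := by
  have hP := one_le_toReal hp hpq.ne_top
  have hV := one_le_toReal hv hvu.ne_top
  have hα := sub_pos.2 (toReal_inv_strictAnti hp hpq)
  have hδ := sub_pos.2 (toReal_inv_strictAnti hv hvu)
  have hR0 : (1 : ℝ) ≤ R := by exact_mod_cast hR1
  have hn : 1 ≤ n := hN₂.trans hnN₂
  have hn0 : (0 : ℝ) < n := by exact_mod_cast hn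
  have h10 : (0 : ℝ) < N₁ := by exact_mod_cast hN₁
  have h20 : (0 : ℝ) < N₂ := by exact_mod_cast hN₂
  have hx1 := one_le_ceil_div hn h10
  have hy1 := one_le_ceil_div hn h20
  have hC := tailConst_pos (V := v.toReal) hδ (show 0 < p.toReal by positivity)
  -- Sampling then costs at most n/2, and k is at least n/(4RN₁).
  generalize hk : n / (2 * R * N₁) = k
  have hden : 0 < 2 * R * N₁ := by positivity
  have hk1 : 1 ≤ k := hk ▸ (Nat.one_le_div_iff hden).2 hnN₁
  have hk0 : (0 : ℝ) < k := by exact_mod_cast hk1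
  have hkn : (2 * R * N₁ : ℝ) * k ≤ n := by
    have : 2 * R * N₁ * k ≤ n := hk ▸ Nat.mul_div_le n (2 * R * N₁)
    exact_mod_cast this
  have hnk : (n : ℝ) ≤ 2 * (2 * R * N₁) * k := by
    have h1 : n < 2 * R * N₁ * (k + 1) := hk ▸ Nat.lt_mul_div_succ n hden
    have h2 : 2 * R * N₁ * 1 ≤ 2 * R * N₁ * k := Nat.mul_le_mul_left _ hk1
    have h3 : n ≤ 2 * (2 * R * N₁) * k := by linarith
    exact_mod_cast h3
  -- Here z is the value of θ^(P/V) that bounds the expected cost of the detected rows by N₁N₂/z =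
  -- n/2.
  obtain ⟨z, hz⟩ : ∃ z : ℝ, z = 2 * N₁ * N₂ / n := ⟨_, rfl⟩
  have hz0 : 0 < z := by rw [hz]; positivity
  have hθP : (z ^ (v.toReal / p.toReal)) ^ (p.toReal / v.toReal) = z := by
    rw [← Real.rpow_mul hz0.le, div_mul_div_cancel₀ (by positivity), div_self (by positivity),
      Real.rpow_one]
  have hcost : (N₁ : ℝ) * (R * k) +
      N₂ * (N₁ / (z ^ (v.toReal / p.toReal)) ^ (p.toReal / v.toReal)) ≤ n := by
    rw [hθP, hz]
    have : (N₂ : ℝ) * (N₁ / (2 * N₁ * N₂ / n)) = n / 2 := by field_simp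
    rw [this]
    linarith
  refine (eRan_le_twoStage hp hpq hN₁ hN₂ hk1 hv hvu (by positivity) hPR hcost).trans
    (ENNReal.ofReal_le_ofReal (add_le_add ?_ ?_))
  · have hnN2' : (1 : ℝ) ≤ n / N₂ := by rw [one_le_div h20]; exact_mod_cast hnN₂
    have h1 := rpow_neg_le_of_le_mul (by linarith) two_pos (by positivity) hα.le
      (ceil_le_two_mul hnN2')
    have h2 : z ^ ((p⁻¹).toReal - (q⁻¹).toReal) = 2 ^ ((p⁻¹).toReal - (q⁻¹).toReal) *
        (N₁ : ℝ) ^ ((p⁻¹).toReal - (q⁻¹).toReal) *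
          ((n : ℝ) / N₂) ^ (-((p⁻¹).toReal - (q⁻¹).toReal)) := by
      rw [Real.rpow_neg (by positivity), ← Real.inv_rpow (by positivity),
        ← Real.mul_rpow (by positivity) (by positivity),
        ← Real.mul_rpow (by positivity) (by positivity), hz]
      congr 1
      field_simp
    rw [Real.mul_rpow (by norm_num) (by positivity),
      Real.rpow_mul (Real.rpow_nonneg hz0.le _), hθP, h2]
    refine (mul_le_mul_of_nonneg_left (mul_le_mul_of_nonneg_left h1 (by positivity))
      (by positivity)).trans (le_of_eq (by ring))
  · have hnN1' : (1 : ℝ) ≤ n / N₁ := by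
      rw [one_le_div h10]
      have : N₁ ≤ n := by nlinarith
      exact_mod_cast this
    have hlarge := rpow_neg_le_of_le_mul (by linarith) (show (0 : ℝ) < 8 * R by positivity) hk0
      hδ.le (show (⌈(n : ℝ) / N₁⌉₊ : ℝ) ≤ 8 * R * k by
        refine (ceil_le_two_mul hnN1').trans ?_
        rw [← mul_div_assoc, div_le_iff₀ h10]
        linarith)
    gcongr

/-- If n < N₂ or n < 2RN₁, one of the two ceilings is bounded, so the bracket is bounded below and
the zero algorithm suffices. Otherwise `eRan_le_of_large` applies. -/
lemma exists_eRan_le (hp : 1 ≤ p) (hpq : p < q) (hv : 1 ≤ v) (hvu : v < u) :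
    ∃ c : ℝ, 0 < c ∧ ∀ n N₁ N₂ : ℕ, 1 ≤ n → 1 ≤ N₁ → 1 ≤ N₂ →
      eRan.{w} (approxProblem 𝕜 p u q v N₁ N₂) n ≤
        ENNReal.ofReal (c * (N₁ : ℝ) ^ ((p⁻¹).toReal - (q⁻¹).toReal) *
          ((⌈(n : ℝ) / N₁⌉₊ : ℝ) ^ ((u⁻¹).toReal - (v⁻¹).toReal) +
            (⌈(n : ℝ) / N₂⌉₊ : ℝ) ^ ((q⁻¹).toReal - (p⁻¹).toReal))) := by
  have hP := one_le_toReal hp hpq.ne_top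
  have hV := one_le_toReal hv hvu.ne_top
  have hα := sub_pos.2 (toReal_inv_strictAnti hp hpq)
  have hδ := sub_pos.2 (toReal_inv_strictAnti hv hvu)
  obtain ⟨R, hR1, hPR⟩ : ∃ R : ℕ, 1 ≤ R ∧ p.toReal ≤ R * v.toReal :=
    ⟨⌈p.toReal / v.toReal⌉₊, Nat.one_le_ceil_iff.2 (by positivity),
      (div_le_iff₀ (by positivity)).1 (Nat.le_ceil _)⟩
  have hR0 : (1 : ℝ) ≤ R := by exact_mod_cast hR1
  have hlarge := fun n N₁ N₂ hN₁ hN₂ hnN₁ hnN₂ => eRan_le_of_large.{w} (𝕜 := 𝕜) (n := n)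
    (N₁ := N₁) (N₂ := N₂) hp hpq hv hvu hR1 hPR hN₁ hN₂ hnN₁ hnN₂
  have hK0 : 0 ≤ (R * tailConst v.toReal ((v⁻¹).toReal - (u⁻¹).toReal) p.toReal) ^
      (1 / p.toReal) :=
    Real.rpow_nonneg (mul_nonneg (by positivity) (tailConst_pos hδ (by positivity)).le) _
  generalize (R * tailConst v.toReal ((v⁻¹).toReal - (u⁻¹).toReal) p.toReal) ^
      (1 / p.toReal) = K at hlarge hK0
  obtain ⟨B, hB⟩ : ∃ B, B = (8 : ℝ) ^ (p.toReal / v.toReal * ((p⁻¹).toReal - (q⁻¹).toReal)) *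
    2 ^ ((p⁻¹).toReal - (q⁻¹).toReal) * 2 ^ ((p⁻¹).toReal - (q⁻¹).toReal) := ⟨_, rfl⟩
  have hB0 : 0 < B := by rw [hB]; positivity
  rw [← hB] at hlarge
  obtain ⟨A, hA⟩ : ∃ A, A = (8 * (R : ℝ)) ^ ((v⁻¹).toReal - (u⁻¹).toReal) := ⟨_, rfl⟩
  have hA0 : 0 < A := by rw [hA]; positivity
  rw [← hA] at hlarge
  -- `A * K` and `B` serve the two error terms for large n; `A` serves small n/N₁, and 1 serves n <
  -- N₂.
  refine ⟨A * (K + 1) + B + 1, by positivity, fun n N₁ N₂ hn hN₁ hN₂ => ?_⟩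
  have h10 : (0 : ℝ) < N₁ := by exact_mod_cast hN₁
  have h20 : (0 : ℝ) < N₂ := by exact_mod_cast hN₂
  have hx1 := one_le_ceil_div hn h10
  have hy1 := one_le_ceil_div hn h20
  rw [← neg_sub (v⁻¹).toReal (u⁻¹).toReal, ← neg_sub (p⁻¹).toReal (q⁻¹).toReal]
  have hzero := eRan_le_eRanNon.trans (eRanNon_le_embedding.{w} (𝕜 := 𝕜) (n := n) hp
    (hp.trans hpq.le) (hv.trans hvu.le) hv hN₁ hN₂)
  rw [max_eq_left hα.le, max_eq_right (by linarith), Real.rpow_zero, mul_one] at hzero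
  have hNα : 0 < (N₁ : ℝ) ^ ((p⁻¹).toReal - (q⁻¹).toReal) := by positivity
  have hX0 : 0 < (⌈(n : ℝ) / N₁⌉₊ : ℝ) ^ (-((v⁻¹).toReal - (u⁻¹).toReal)) := by positivity
  have hY0 : 0 < (⌈(n : ℝ) / N₂⌉₊ : ℝ) ^ (-((p⁻¹).toReal - (q⁻¹).toReal)) := by positivity
  by_cases hnN2 : n < N₂
  · refine hzero.trans (ENNReal.ofReal_le_ofReal ?_)
    have hy : (⌈(n : ℝ) / N₂⌉₊ : ℝ) = 1 := by
      have : ⌈(n : ℝ) / N₂⌉₊ ≤ 1 := Nat.ceil_le.2 (by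
        rw [Nat.cast_one, div_le_one h20]; exact_mod_cast hnN2.le)
      exact le_antisymm (by exact_mod_cast this) hy1
    rw [hy, Real.one_rpow, mul_right_comm]
    refine le_mul_of_one_le_left hNα.le (one_le_mul_of_one_le_of_one_le ?_ (by linarith))
    have : 0 ≤ A * (K + 1) := by positivity
    linarith
  by_cases hnN1 : n < 2 * R * N₁
  · refine hzero.trans (ENNReal.ofReal_le_ofReal ?_)
    have hx2 : (⌈(n : ℝ) / N₁⌉₊ : ℝ) ≤ 8 * R * 1 := by
      have h1 : ⌈(n : ℝ) / N₁⌉₊ ≤ 2 * R := Nat.ceil_le.2 (by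
        rw [div_le_iff₀ h10]; exact_mod_cast hnN1.le)
      have h2 : (⌈(n : ℝ) / N₁⌉₊ : ℝ) ≤ 2 * R := by exact_mod_cast h1
      linarith
    have h1 := rpow_neg_le_of_le_mul (by linarith) (by positivity) one_pos hδ.le hx2
    rw [Real.one_rpow, ← hA] at h1
    rw [mul_right_comm]
    refine le_mul_of_one_le_left hNα.le (h1.trans ?_)
    refine mul_le_mul ?_ (by linarith) hX0.le (by positivity)
    have : 0 ≤ A * K := by positivity
    linarith
  refine (hlarge n N₁ N₂ hN₁ hN₂ (not_lt.1 hnN1) (not_lt.1 hnN2)).trans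
    (ENNReal.ofReal_le_ofReal ?_)
  generalize (⌈(n : ℝ) / N₁⌉₊ : ℝ) ^ (-((v⁻¹).toReal - (u⁻¹).toReal)) = X at *
  generalize (⌈(n : ℝ) / N₂⌉₊ : ℝ) ^ (-((p⁻¹).toReal - (q⁻¹).toReal)) = Y at *
  generalize (N₁ : ℝ) ^ ((p⁻¹).toReal - (q⁻¹).toReal) = Z at *
  have h1 : (A * (K + 1) + B + 1) * Z * (X + Y) = B * (Z * Y) + Z * (K * (A * X)) +
      ((A + B + 1) * Z * X + (A * (K + 1) + 1) * Z * Y) := by ring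
  rw [h1]
  exact le_add_of_nonneg_right (by positivity)

lemma ceil_six_mul_div_le (n N : ℕ) :
    ⌈(6 * n : ℝ) / N⌉₊ ≤ 6 * ⌈(n : ℝ) / N⌉₊ := by
  refine Nat.ceil_le.2 ?_
  push_cast
  rw [mul_div_assoc]
  gcongr
  exact Nat.le_ceil _

lemma one_sixth_mul_rpow_neg_le {m l : ℕ} {s : ℝ} (hs : 0 ≤ s) (hs1 : s ≤ 1) (hm : 1 ≤ m)
    (h : m ≤ 6 * l) : (l : ℝ) ^ (-s) / 6 ≤ (m : ℝ) ^ (-s) := by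
  have hm0 : (0 : ℝ) < m := by exact_mod_cast hm
  have hl0 : (0 : ℝ) < l := by
    have : 0 < l := by omega
    exact_mod_cast this
  have h1 := rpow_neg_le_of_le_mul hm0 (b := 6) (by norm_num) hl0 hs (by exact_mod_cast h)
  have h2 : (6 : ℝ) ^ s ≤ 6 := by
    simpa using Real.rpow_le_rpow_of_exponent_le (by norm_num : (1 : ℝ) ≤ 6) hs1
  have h3 : 0 ≤ (m : ℝ) ^ (-s) := by positivity
  nlinarith

/-- The least m and k with 6n ≤ mN₂ and 6n ≤ N₁k are admissible for `le_eRan_of_rows` and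
`le_eRan_of_residues`. The larger of the two bounds is at least half the sum of the target terms; 72
is 6 from the residues, 6 from rescaling 6n to n in the ceilings, and 2 from this. -/
lemma le_eRan_of_lt (hp : 1 ≤ p) (hpq : p < q) (hv : 1 ≤ v) (hvu : v < u) {n N₁ N₂ : ℕ}
    (hn : 1 ≤ n) (hN₁ : 1 ≤ N₁) (hN₂ : 1 ≤ N₂) (hn6 : 6 * n ≤ N₁ * N₂) :
    ENNReal.ofReal (1 / 72 * (N₁ : ℝ) ^ ((p⁻¹).toReal - (q⁻¹).toReal) *
        ((⌈(n : ℝ) / N₁⌉₊ : ℝ) ^ ((u⁻¹).toReal - (v⁻¹).toReal) +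
          (⌈(n : ℝ) / N₂⌉₊ : ℝ) ^ ((q⁻¹).toReal - (p⁻¹).toReal))) ≤
      eRan.{w} (approxProblem 𝕜 p u q v N₁ N₂) n := by
  have hq := hp.trans hpq.le
  have hu := hv.trans hvu.le
  have hα := sub_pos.2 (toReal_inv_strictAnti hp hpq)
  have hδ := sub_pos.2 (toReal_inv_strictAnti hv hvu)
  have hn0 : (0 : ℝ) < n := by exact_mod_cast hn
  have h10 : (0 : ℝ) < N₁ := by exact_mod_cast hN₁
  have h20 : (0 : ℝ) < N₂ := by exact_mod_cast hN₂
  have hn6' : (6 * n : ℝ) ≤ N₁ * N₂ := by exact_mod_cast hn6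
  set m := ⌈(6 * n : ℝ) / N₂⌉₊
  have hm1 : 1 ≤ m := Nat.one_le_ceil_iff.2 (by positivity)
  have hm0 : (0 : ℝ) < m := by exact_mod_cast hm1
  have hmN : m ≤ N₁ := Nat.ceil_le.2 (by rwa [div_le_iff₀ h20])
  have hnm : 6 * n ≤ m * N₂ := by
    have : (6 * n : ℝ) ≤ m * N₂ := (div_le_iff₀ h20).1 (Nat.le_ceil ((6 * n : ℝ) / N₂))
    exact_mod_cast this
  set k := ⌈(6 * n : ℝ) / N₁⌉₊
  have hk1 : 1 ≤ k := Nat.one_le_ceil_iff.2 (by positivity)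
  have hkN : k ≤ N₂ := Nat.ceil_le.2 (by rw [div_le_iff₀ h10]; linarith)
  have hnk : 6 * n ≤ N₁ * k := by
    have : (6 * n : ℝ) ≤ N₁ * k := (div_le_iff₀' h10).1 (Nat.le_ceil ((6 * n : ℝ) / N₁))
    exact_mod_cast this
  have hrows := le_eRan_of_rows.{w} (𝕜 := 𝕜) hp hq hu hv hN₂ hm1 hmN hnm
  have hres := le_eRan_of_residues.{w} (𝕜 := 𝕜) hp hq hu hv hN₁ hk1 hkN hnk
  have hm6 := one_sixth_mul_rpow_neg_le hα.le
    (by linarith [toReal_inv_le_one hp, ENNReal.toReal_nonneg (a := q⁻¹)]) hm1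
    (ceil_six_mul_div_le n N₂)
  have hk6 := one_sixth_mul_rpow_neg_le hδ.le
    (by linarith [toReal_inv_le_one hv, ENNReal.toReal_nonneg (a := u⁻¹)]) hk1
    (ceil_six_mul_div_le n N₁)
  rw [← neg_sub (v⁻¹).toReal] at hres ⊢
  rw [← neg_sub (p⁻¹).toReal (q⁻¹).toReal] at hrows ⊢
  set α := (p⁻¹).toReal - (q⁻¹).toReal
  set δ := (v⁻¹).toReal - (u⁻¹).toReal
  have e : ((m : ℝ) / N₁) ^ (-α) = (N₁ : ℝ) ^ α * (m : ℝ) ^ (-α) := by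
    rw [Real.div_rpow hm0.le h10.le, Real.rpow_neg h10.le, div_inv_eq_mul, mul_comm]
  rw [e] at hrows
  have hNα : 0 ≤ (N₁ : ℝ) ^ α := by positivity
  have hm6' := mul_le_mul_of_nonneg_left hm6 hNα
  have hk6' := mul_le_mul_of_nonneg_left hk6 hNα
  rcases le_total ((⌈(n : ℝ) / N₁⌉₊ : ℝ) ^ (-δ)) ((⌈(n : ℝ) / N₂⌉₊ : ℝ) ^ (-α)) with h | h
  · refine (ENNReal.ofReal_le_ofReal ?_).trans hrows
    have := mul_le_mul_of_nonneg_left h hNα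
    have h0 : 0 ≤ (N₁ : ℝ) ^ α * (m : ℝ) ^ (-α) := by positivity
    linarith
  · refine (ENNReal.ofReal_le_ofReal ?_).trans hres
    have := mul_le_mul_of_nonneg_left h hNα
    linarith

/-- One family attains the norm of the embedding in each case: signs everywhere if neither exponent
is positive, one spike per row if only the inner one may be, a single spike in the whole array if p
< q and u ≤ v. -/
lemma le_eRan_of_le_or_le (hp : 1 ≤ p) (hq : 1 ≤ q) (hu : 1 ≤ u) (hv : 1 ≤ v) {n N₁ N₂ : ℕ}
    (hN₁ : 1 ≤ N₁) (hN₂ : 1 ≤ N₂) (hn : 6 * n ≤ N₁ * N₂) (h : q ≤ p ∨ u ≤ v) :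
    ENNReal.ofReal (1 / 6 * ((N₁ : ℝ) ^ max ((p⁻¹).toReal - (q⁻¹).toReal) 0 *
      (N₂ : ℝ) ^ max ((u⁻¹).toReal - (v⁻¹).toReal) 0)) ≤
      eRan.{w} (approxProblem 𝕜 p u q v N₁ N₂) n := by
  have h10 : (N₁ : ℝ) ≠ 0 := by exact_mod_cast (by omega : N₁ ≠ 0)
  rcases le_or_gt q p with hqp | hpq
  · rw [max_eq_right (sub_nonpos.2 (toReal_inv_anti hq hqp)), Real.rpow_zero, one_mul]
    rcases le_or_gt v u with hvu | huv
    · rw [max_eq_right (sub_nonpos.2 (toReal_inv_anti hv hvu)), Real.rpow_zero, mul_one]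
      have := le_eRan_of_rows.{w} (𝕜 := 𝕜) hp hq hu hv hN₂ hN₁ le_rfl hn
      rw [div_self h10, Real.one_rpow] at this
      exact (ENNReal.ofReal_le_ofReal (by norm_num)).trans this
    · rw [max_eq_left (sub_nonneg.2 (toReal_inv_anti hu huv.le))]
      refine (ENNReal.ofReal_le_ofReal ?_).trans
        (le_eRan_of_columns hp hq hu hv hN₁ hN₂ hn)
      have : 0 ≤ (N₂ : ℝ) ^ ((u⁻¹).toReal - (v⁻¹).toReal) := by positivity
      linarith
  · have huv : u ≤ v := h.resolve_left (not_le.2 hpq)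
    rw [max_eq_left (sub_nonneg.2 (toReal_inv_anti hp hpq.le)),
      max_eq_left (sub_nonneg.2 (toReal_inv_anti hu huv))]
    exact (ENNReal.ofReal_le_ofReal (le_of_eq (by ring))).trans
      (le_eRan_of_residues hp hq hu hv hN₁ hN₂ le_rfl hn)

lemma ceil_div_rpow_le {n : ℕ} {N L s : ℝ} (hn : 1 ≤ n) (hN : 0 < N) (hL : 1 ≤ L) (hs : s ≤ 0) :
    (⌈(n : ℝ) / N⌉₊ : ℝ) ^ s ≤ (⌈(n : ℝ) / (N * L)⌉₊ : ℝ) ^ s := by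
  refine Real.rpow_le_rpow_of_nonpos
    (zero_lt_one.trans_le (one_le_ceil_div hn (by positivity))) ?_ hs
  gcongr
  exact le_mul_of_one_le_right hN.le hL

end Rates

end IBC

/-! ### Assembly of the theorem -/

theorem theorem1 {𝕜 : Type*} [RCLike 𝕜] [MeasurableSpace 𝕜] [BorelSpace 𝕜]
    (p q u v : ℝ≥0∞) (hp : 1 ≤ p) (hq : 1 ≤ q) (hu : 1 ≤ u) (hv : 1 ≤ v) :
    ∃ c₀ c₁ c₂ c₃ c₄ c₅ c₆ : ℝ, 0 < c₀ ∧ c₀ < 1 ∧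
      0 < c₁ ∧ 0 < c₂ ∧ 0 < c₃ ∧ 0 < c₄ ∧ 0 < c₅ ∧ 0 < c₆ ∧
      ∀ n N₁ N₂ : ℕ, 1 ≤ n → 1 ≤ N₁ → 1 ≤ N₂ → (n : ℝ) < c₀ * N₁ * N₂ →
        ((q ≤ p ∨ u ≤ v) →
          ENNReal.ofReal (c₁ *
              ((N₁ : ℝ) ^ max ((p⁻¹).toReal - (q⁻¹).toReal) 0 *
                (N₂ : ℝ) ^ max ((u⁻¹).toReal - (v⁻¹).toReal) 0))
            ≤ IBC.eRan.{w} (IBC.approxProblem 𝕜 p u q v N₁ N₂) n ∧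
          IBC.eRan.{w} (IBC.approxProblem 𝕜 p u q v N₁ N₂) n
            ≤ IBC.eRanNon.{w} (IBC.approxProblem 𝕜 p u q v N₁ N₂) n ∧
          IBC.eRanNon.{w} (IBC.approxProblem 𝕜 p u q v N₁ N₂) n
            ≤ ENNReal.ofReal (c₂ *
              ((N₁ : ℝ) ^ max ((p⁻¹).toReal - (q⁻¹).toReal) 0 *
                (N₂ : ℝ) ^ max ((u⁻¹).toReal - (v⁻¹).toReal) 0))) ∧
        ((p < q ∧ v < u) →
          (ENNReal.ofReal (c₃ * (N₁ : ℝ) ^ ((p⁻¹).toReal - (q⁻¹).toReal) *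
              ((⌈(n : ℝ) / N₁⌉₊ : ℝ) ^ ((u⁻¹).toReal - (v⁻¹).toReal) +
                (⌈(n : ℝ) / N₂⌉₊ : ℝ) ^ ((q⁻¹).toReal - (p⁻¹).toReal)))
            ≤ IBC.eRan.{w} (IBC.approxProblem 𝕜 p u q v N₁ N₂) n ∧
          IBC.eRan.{w} (IBC.approxProblem 𝕜 p u q v N₁ N₂) n
            ≤ ENNReal.ofReal (c₄ * (N₁ : ℝ) ^ ((p⁻¹).toReal - (q⁻¹).toReal) *
              ((⌈(n : ℝ) / (N₁ * Real.logb 2 (N₁ + N₂))⌉₊ : ℝ) ^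
                  ((u⁻¹).toReal - (v⁻¹).toReal) +
                (⌈(n : ℝ) / (N₂ * Real.logb 2 (N₁ + N₂))⌉₊ : ℝ) ^
                  ((q⁻¹).toReal - (p⁻¹).toReal)))) ∧
          (ENNReal.ofReal (c₅ * (N₁ : ℝ) ^ ((p⁻¹).toReal - (q⁻¹).toReal))
            ≤ IBC.eRanNon.{w} (IBC.approxProblem 𝕜 p u q v N₁ N₂) n ∧
          IBC.eRanNon.{w} (IBC.approxProblem 𝕜 p u q v N₁ N₂) n
            ≤ ENNReal.ofReal (c₆ * (N₁ : ℝ) ^ ((p⁻¹).toReal - (q⁻¹).toReal)))) := by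
  -- The constants are chosen before the case distinction, so `c₄` needs a dummy value when the
  -- second case does not occur.
  have hc : ∃ c : ℝ, 0 < c ∧ (p < q ∧ v < u → ∀ n N₁ N₂ : ℕ, 1 ≤ n → 1 ≤ N₁ → 1 ≤ N₂ →
      IBC.eRan.{w} (IBC.approxProblem 𝕜 p u q v N₁ N₂) n ≤
        ENNReal.ofReal (c * (N₁ : ℝ) ^ ((p⁻¹).toReal - (q⁻¹).toReal) *
          ((⌈(n : ℝ) / N₁⌉₊ : ℝ) ^ ((u⁻¹).toReal - (v⁻¹).toReal) +
            (⌈(n : ℝ) / N₂⌉₊ : ℝ) ^ ((q⁻¹).toReal - (p⁻¹).toReal)))) := by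
    by_cases h : p < q ∧ v < u
    · obtain ⟨c, hc, hle⟩ := IBC.exists_eRan_le.{w} (𝕜 := 𝕜) hp h.1 hv h.2
      exact ⟨c, hc, fun _ => hle⟩
    · exact ⟨1, one_pos, fun h' => absurd h' h⟩
  obtain ⟨c₄, hc₄, hle⟩ := hc
  refine ⟨1 / 6, 1 / 6, 1, 1 / 72, c₄, 1 / 3, 1, by norm_num, by norm_num, by norm_num,
    by norm_num, by norm_num, hc₄, by norm_num, by norm_num,
    fun n N₁ N₂ hn hN₁ hN₂ hnN => ?_⟩
  have hn6 : 6 * n ≤ N₁ * N₂ := by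
    have : (6 * n : ℝ) ≤ N₁ * N₂ := by linarith
    exact_mod_cast this
  have h10 : (0 : ℝ) < N₁ := by exact_mod_cast hN₁
  have h20 : (0 : ℝ) < N₂ := by exact_mod_cast hN₂
  have hzero := IBC.eRanNon_le_embedding.{w} (𝕜 := 𝕜) (n := n) hp hq hu hv hN₁ hN₂
  refine ⟨fun h => ⟨IBC.le_eRan_of_le_or_le hp hq hu hv hN₁ hN₂ hn6 h, IBC.eRan_le_eRanNon, ?_⟩,
    fun h => ⟨⟨IBC.le_eRan_of_lt hp h.1 hv h.2 hn hN₁ hN₂ hn6, ?_⟩, ?_, ?_⟩⟩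
  · rwa [one_mul]
  · refine (hle h n N₁ N₂ hn hN₁ hN₂).trans (ENNReal.ofReal_le_ofReal ?_)
    -- The logarithm is at least 1 as N₁ + N₂ ≥ 2. It only shrinks the ceilings, and the exponents
    -- are nonpositive, so the stated bound is weaker than the one without it.
    have hL : 1 ≤ Real.logb 2 (N₁ + N₂) := by
      have h1 : (1 : ℝ) ≤ N₁ := by exact_mod_cast hN₁
      have h2 : (1 : ℝ) ≤ N₂ := by exact_mod_cast hN₂
      rw [Real.le_logb_iff_rpow_le one_lt_two (by linarith), Real.rpow_one]
      linarith
    gcongr ?_ * (?_ + ?_)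
    · exact IBC.ceil_div_rpow_le hn h10 hL (sub_nonpos.2 (IBC.toReal_inv_anti hv h.2.le))
    · exact IBC.ceil_div_rpow_le hn h20 hL (sub_nonpos.2 (IBC.toReal_inv_anti hp h.1.le))
  · exact (ENNReal.ofReal_le_ofReal (le_of_eq (by ring))).trans
      (IBC.le_eRanNon_of_row hp hq hu hv hN₁ hN₂ hn6)
  · rw [max_eq_left (sub_nonneg.2 (IBC.toReal_inv_anti hp h.1.le)),
      max_eq_right (sub_nonpos.2 (IBC.toReal_inv_anti hv h.2.le)), Real.rpow_zero, mul_one] at hzero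
    rwa [one_mul]
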